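/- **Definitions.** Let $\Sigma$ be a finite alphabet and $\Pi\subseteq\Sigma^n$ a property. A string $x\in\Sigma^n$ is $\varepsilon$-far from $\Pi$ if for every $y\in\Pi$ the relative Hamming distance $\frac1n|\{i: x_i\ne y_i\}|$ is larger than $\varepsilon$. A query algorithm is a probability distribution over adaptive decision trees that query coordinates of $x$ and output a bit; it makes at most $q$ queries if every tree in its support makes at most $q$ queries on every input. An MA proof of proximity (MAP) for $\Pi$ with proof length $m$, query complexity $q$ and proximity parameter $\delta$ assigns to each proof $w\in\Sigma^m$ a query algorithm $V_w$ making at most $q$ queries, such that (i) for every $x\in\Pi$ there is $w$ with $\Pr[V_w^x=1]\ge 2/3$, and (ii) for every $x$ that is $\delta$-far from $\Pi$ and every $w$, $\Pr[V_w^x=0]\ge 2/3$. A sample-based algorithm with sample complexity $s$ draws a set $Q\subseteq[n]$ containing each coordinate independently with some fixed probability $p$; if $|Q|\le s$ it outputs a (possibly randomised) function of $Q$ and $x|_Q$, and otherwise its output does not depend on $x$. It is a sample-based $\varepsilon$-tester for $\Pi$ if it outputs $1$ with probability at least $2/3$ on every $x\in\Pi$ and $0$ with probability at least $2/3$ on every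 $x$ that is $\varepsilon$-far from $\Pi$. **Theorem.** There is an absolute constant $C>0$ such that for every $\varepsilon>0$ there is $A=A(\varepsilon)>0$ for which the following holds. Let $\Sigma$ be a finite alphabet and let $n,m,q$ be non-negative integers with $q\ge 2$ and $$ n\ \ge\ |\Sigma|^{A\,q^3\log^3 q} $$ (so for fixed $\varepsilon,q,\Sigma$ this holds for all sufficiently large $n$; $m$ is arbitrary). If a property $\Pi\subseteq\Sigma^n$ admits a MAP with proof length $m$, query complexity $q$ and proximity parameter $\varepsilon/2$, then $\Pi$ admits a sample-based $\varepsilon$-tester with sample complexity at most $$ \max\{1,m\}\cdot n^{\,1-\frac{1}{C\,q^2\log^2 q}} . $$ Here $\log$ is the natural logarithm. -/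

import Mathlib

open scoped NNReal ENNReal

universe u

namespace LocalTest

/-- The string `x` is `ε`-far from the property `P`: its relative Hamming distance to every
element of `P` exceeds `ε`. -/
def IsFar {α : Type u} [DecidableEq α] {n : ℕ} (ε : ℝ) (x : Fin n → α)
    (P : Set (Fin n → α)) : Prop :=
  ∀ y ∈ P, ε < (hammingDist x y : ℝ) / (n : ℝ)

/-- Decision trees over strings in `α ^ n`: a deterministic, adaptive algorithm that queries
coordinates of its input and finally outputs a bit. -/
inductive DecisionTree (α : Type u) (n : ℕ) : Type u where
  | leaf (b : Bool) : DecisionTree α n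
  | query (i : Fin n) (next : α → DecisionTree α n) : DecisionTree α n

namespace DecisionTree

/-- The output of the tree on input `x`. -/
def output {α : Type u} {n : ℕ} : DecisionTree α n → (Fin n → α) → Bool
  | leaf b, _ => b
  | query i next, x => (next (x i)).output x

/-- The number of queries that the tree makes on input `x`. -/
def numQueries {α : Type u} {n : ℕ} : DecisionTree α n → (Fin n → α) → ℕ
  | leaf _, _ => 0
  | query i next, x => (next (x i)).numQueries x + 1

end DecisionTree

/-- A randomised adaptive query algorithm: its coin tosses select a decision tree. -/
abbrev QueryAlg (α : Type u) (n : ℕ) : Type u := PMF (DecisionTree α n)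

/-- The distribution of the output of a query algorithm on input `x`. -/
noncomputable def QueryAlg.run {α : Type u} {n : ℕ} (M : QueryAlg α n) (x : Fin n → α) :
    PMF Bool :=
  PMF.map (fun T : DecisionTree α n => T.output x) M

/-- At most `q` queries are made, for every input and every outcome of the coin tosses. -/
def QueryAlg.QueryBound {α : Type u} {n : ℕ} (M : QueryAlg α n) (q : ℕ) : Prop :=
  ∀ T ∈ M.support, ∀ x : Fin n → α, T.numQueries x ≤ q

/-- `V` is an MA proof of proximity for the property `P`, with proof length `m` (over the alphabet
of the input), query complexity `q`, proximity parameter `ε` and error rate `σ`. The verifier reads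
the whole proof, which selects the query algorithm that it runs on the input. -/
structure IsMAP {α : Type u} [DecidableEq α] {n m : ℕ} (V : (Fin m → α) → QueryAlg α n)
    (P : Set (Fin n → α)) (q : ℕ) (ε σ : ℝ) : Prop where
  queryBound : ∀ w : Fin m → α, (V w).QueryBound q
  complete : ∀ x ∈ P, ∃ w : Fin m → α, 1 - σ ≤ ((V w).run x true).toReal
  sound : ∀ x : Fin n → α, IsFar ε x P →
    ∀ w : Fin m → α, 1 - σ ≤ ((V w).run x false).toReal

theorem sum_sampleWeight (n : ℕ) (p : ℝ≥0) (hp : p ≤ 1) :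
    ∑ Q : Finset (Fin n), ((p ^ Q.card * (1 - p) ^ (n - Q.card) : ℝ≥0) : ℝ≥0∞) = 1 := by
  have h := Fintype.sum_pow_mul_eq_add_pow (Fin n) p (1 - p)
  rw [Fintype.card_fin, add_tsub_cancel_of_le hp, one_pow] at h
  rw [← ENNReal.ofNNReal_finsetSum, h, ENNReal.coe_one]

/-- The random set of coordinates that contains each `i : Fin n` independently with
probability `p`. -/
noncomputable def sampleSet (n : ℕ) (p : ℝ≥0) (hp : p ≤ 1) : PMF (Finset (Fin n)) :=
  PMF.ofFintype (fun Q => ((p ^ Q.card * (1 - p) ^ (n - Q.card) : ℝ≥0) : ℝ≥0∞))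
    (sum_sampleWeight n p hp)

/-- A sample-based algorithm on strings in `α ^ n`. It draws a set `Q` of coordinates, each
coordinate independently with probability `prob`. If `Q` has at most `cap` elements it
queries exactly the coordinates in `Q` and computes its (possibly randomised) output from `Q` and
the restriction of the input to `Q`; otherwise it makes no query and outputs arbitrarily. -/
structure SampleAlg (α : Type u) (n : ℕ) where
  prob : ℝ≥0
  prob_le_one : prob ≤ 1
  cap : ℕ
  decision : (Q : Finset (Fin n)) → ((i : Fin n) → i ∈ Q → α) → PMF Bool
  overflow : Finset (Fin n) → PMF Bool

/-- The distribution of the output of a sample-based algorithm on input `x`. -/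
noncomputable def SampleAlg.run {α : Type u} {n : ℕ} (S : SampleAlg α n) (x : Fin n → α) :
    PMF Bool :=
  (sampleSet n S.prob S.prob_le_one).bind fun Q =>
    if Q.card ≤ S.cap then S.decision Q (fun i _ => x i) else S.overflow Q

/-- The sample-based algorithm `S` is an `ε`-tester with error rate `σ` for the property `P`. -/
structure SampleAlg.IsTester {α : Type u} [DecidableEq α] {n : ℕ} (S : SampleAlg α n)
    (P : Set (Fin n → α)) (ε σ : ℝ) : Prop where
  complete : ∀ x ∈ P, 1 - σ ≤ (S.run x true).toReal
  sound : ∀ x : Fin n → α, IsFar ε x P → 1 - σ ≤ (S.run x false).toReal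

end LocalTest

namespace LocalTest

/-! Majority voting over O(log q) runs gives, for every proof w, an algorithm with l = O(q log q)
queries and soundness error at most 1/(16(l+1)). A sample of density p rarely contains all queries
of a run, but weighting each visible run by the inverse probability of being seen gives an unbiased
estimate of the acceptance probability. This estimate concentrates only if no coordinate is queried
too often.

Coordinates are therefore split by influence, the probability of being queried on a random input;
influences sum to at most l. Among l+1 disjoint influence intervals, every run avoids one, so some
level j carries a 1/(l+1) share of the acceptance probability by runs that query only heavy
coordinates (influence at least `t (j + 1)`) and light ones (less than `t j`). The heavy set, the
kernel, has at most l/`t (j + 1)` elements. The tester tries every assignment to it and accepts if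
for some proof, level and assignment the estimate is large. Completeness uses the true assignment
and a second moment. For soundness, changing the small kernel leaves the input ε/2-far, so every
estimate has small mean, and a k-th moment bound (`petalSum_upper_tail`) survives the union bound.

The union bound needs k of order m + l/`t (j + 1)` up to factors in l and the alphabet, whereas the
light degree is proportional to `t j` (`sum_petal_weight_le`). The gap between consecutive
thresholds pays for the difference and for the inverse powers of p. -/

/-! ### Expectations over a random sample -/

/-- The expectation of `f Q`, where `Q` contains each coordinate independently with
probability `p`. -/
noncomputable def sampleMean (n : ℕ) (p : ℝ) (f : Finset (Fin n) → ℝ) : ℝ :=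
  ∑ Q : Finset (Fin n), p ^ Q.card * (1 - p) ^ (n - Q.card) * f Q

section sampleMean

variable {n : ℕ} {p : ℝ}

theorem sampleMean_const (c : ℝ) : sampleMean n p (fun _ => c) = c := by
  have h := Fintype.sum_pow_mul_eq_add_pow (Fin n) p (1 - p)
  rw [Fintype.card_fin, add_sub_cancel, one_pow] at h
  rw [sampleMean, ← Finset.sum_mul, h, one_mul]

theorem sampleMean_mono (h0 : 0 ≤ p) (h1 : p ≤ 1) {f g : Finset (Fin n) → ℝ}
    (h : ∀ Q, f Q ≤ g Q) : sampleMean n p f ≤ sampleMean n p g := by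
  have : 0 ≤ 1 - p := sub_nonneg.2 h1
  exact Finset.sum_le_sum fun Q _ => mul_le_mul_of_nonneg_left (h Q) (by positivity)

theorem sampleMean_const_mul (c : ℝ) (f : Finset (Fin n) → ℝ) :
    sampleMean n p (fun Q => c * f Q) = c * sampleMean n p f := by
  simp only [sampleMean, Finset.mul_sum]
  exact Finset.sum_congr rfl fun Q _ => by ring

theorem sampleMean_add (f g : Finset (Fin n) → ℝ) :
    sampleMean n p (fun Q => f Q + g Q) = sampleMean n p f + sampleMean n p g := by
  simp only [sampleMean, mul_add, Finset.sum_add_distrib]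

theorem sampleMean_sub (f g : Finset (Fin n) → ℝ) :
    sampleMean n p (fun Q => f Q - g Q) = sampleMean n p f - sampleMean n p g := by
  simp only [sampleMean, mul_sub, Finset.sum_sub_distrib]

theorem sampleMean_sum {ι : Type*} (s : Finset ι) (f : ι → Finset (Fin n) → ℝ) :
    sampleMean n p (fun Q => ∑ i ∈ s, f i Q) = ∑ i ∈ s, sampleMean n p (f i) := by
  simp only [sampleMean, Finset.mul_sum]
  exact Finset.sum_comm

theorem sampleMean_ite_mem (i : Fin n) (g : Finset (Fin n) → ℝ) :
    sampleMean n p (fun Q => if i ∈ Q then g Q else 0) =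
      p * sampleMean n p (fun Q => g (insert i Q)) := by
  have hu : (Finset.univ : Finset (Finset (Fin n))) =
      (insert i (Finset.univ.erase i)).powerset := by
    rw [Finset.insert_erase (Finset.mem_univ i), Finset.powerset_univ]
  simp only [sampleMean]
  rw [hu, Finset.sum_powerset_insert (Finset.notMem_erase i _),
    Finset.sum_powerset_insert (Finset.notMem_erase i _), ← Finset.sum_add_distrib,
    ← Finset.sum_add_distrib, Finset.mul_sum]
  refine Finset.sum_congr rfl fun Q hQ => ?_
  have hi : i ∉ Q := fun h => Finset.notMem_erase i _ (Finset.mem_powerset.1 hQ h)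
  have hc : Q.card + 1 ≤ n := by
    rw [← Finset.card_insert_of_notMem hi]
    simpa using Finset.card_le_univ (insert i Q)
  obtain ⟨c, hc⟩ := Nat.exists_eq_add_of_le hc
  have e1 : n - Q.card = c + 1 := by omega
  have e2 : n - (Q.card + 1) = c := by omega
  rw [Finset.card_insert_of_notMem hi, e1, e2]
  simp only [hi, Finset.mem_insert_self, Finset.insert_idem, if_true, if_false]
  ring

/-- Conditioning on R being sampled leaves the other coordinates independent, so it amounts to
planting R in a fresh sample. The moment recursion for the estimator rests on this. -/
theorem sampleMean_ite_subset (R : Finset (Fin n)) (g : Finset (Fin n) → ℝ) :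
    sampleMean n p (fun Q => if R ⊆ Q then g Q else 0) =
      p ^ R.card * sampleMean n p (fun Q => g (Q ∪ R)) := by
  induction R using Finset.induction_on generalizing g with
  | empty => simp
  | insert i R hi ih =>
    have h1 : ∀ Q : Finset (Fin n), (if insert i R ⊆ Q then g Q else 0) =
        if i ∈ Q then (if R ⊆ Q then g Q else 0) else 0 := by
      intro Q
      simp only [Finset.insert_subset_iff, ite_and]
    have h2 : ∀ Q : Finset (Fin n), (if R ⊆ insert i Q then g (insert i Q) else 0) =
        if R ⊆ Q then g (insert i Q) else 0 := by
      intro Q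
      simp only [Finset.subset_insert_iff_of_notMem hi]
    simp only [h1, sampleMean_ite_mem, h2]
    rw [ih, Finset.card_insert_of_notMem hi, pow_succ]
    simp only [Finset.union_insert]
    ring

theorem sampleMean_card : sampleMean n p (fun Q => (Q.card : ℝ)) = n * p := by
  have h : ∀ Q : Finset (Fin n), (Q.card : ℝ) = ∑ i : Fin n, if i ∈ Q then (1 : ℝ) else 0 := by
    intro Q; simp
  simp only [h]
  rw [sampleMean_sum]
  simp only [sampleMean_ite_mem, sampleMean_const]
  simp

theorem sampleMean_card_gt_le (h0 : 0 ≤ p) (h1 : p ≤ 1) (c : ℕ) :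
    sampleMean n p (fun Q => if Q.card ≤ c then 0 else 1) ≤ n * p / (c + 1) := by
  calc _ ≤ sampleMean n p (fun Q => ((c : ℝ) + 1)⁻¹ * Q.card) := by
        refine sampleMean_mono h0 h1 fun Q => ?_
        split_ifs with hQ
        · positivity
        · rw [inv_mul_eq_div, one_le_div (by positivity)]
          exact_mod_cast Nat.lt_of_not_le hQ
    _ = _ := by rw [sampleMean_const_mul, sampleMean_card, inv_mul_eq_div]

theorem sampleMean_one (f : Finset (Fin n) → ℝ) : sampleMean n 1 f = f Finset.univ := by
  rw [sampleMean, Finset.sum_eq_single Finset.univ]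
  · simp
  · intro Q _ hQ
    have h : Q.card < n := by
      simpa using Finset.card_lt_card (Finset.ssubset_univ_iff.2 hQ)
    simp [Nat.sub_ne_zero_of_lt h]
  · simp

end sampleMean

/-! ### The inverse probability estimator and its tails -/

/-- The inverse probability estimator for the total weight `∑ ω, c ω`, given that only those `ω`
can be seen whose set `S ω` is contained in the sample `Q`. -/
noncomputable def petalSum {Ω : Type*} [Fintype Ω] {n : ℕ} (p : ℝ) (c : Ω → ℝ)
    (S : Ω → Finset (Fin n)) (Q : Finset (Fin n)) : ℝ :=
  ∑ ω, if S ω ⊆ Q then c ω * (p ^ (S ω).card)⁻¹ else 0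

section petalSum

variable {Ω : Type*} [Fintype Ω] {n : ℕ} {p : ℝ} {c : Ω → ℝ} {S : Ω → Finset (Fin n)}

theorem petalSum_nonneg (h0 : 0 < p) (hc : ∀ ω, 0 ≤ c ω) (Q : Finset (Fin n)) :
    0 ≤ petalSum p c S Q := by
  refine Finset.sum_nonneg fun ω _ => ?_
  have := hc ω
  split_ifs <;> positivity

theorem sampleMean_petalSum (h0 : 0 < p) :
    sampleMean n p (petalSum p c S) = ∑ ω, c ω := by
  change sampleMean n p (fun Q => ∑ ω, _) = _
  rw [sampleMean_sum]
  refine Finset.sum_congr rfl fun ω _ => ?_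
  rw [sampleMean_ite_subset, sampleMean_const]
  field_simp

/-- The left side is the mean of the estimator once U is planted in the sample. A petal disjoint
from U still contributes c ω on average; one that meets U is charged, at its full inflated weight,
to an element of U, where the degree bound B applies. -/
theorem sum_petal_inter_le (h0 : 0 < p) (h1 : p ≤ 1) (hc : ∀ ω, 0 ≤ c ω) {B : ℝ}
    (hB : ∀ i, ∑ ω, (if i ∈ S ω then c ω * (p ^ (S ω).card)⁻¹ else 0) ≤ B)
    (U : Finset (Fin n)) :
    ∑ ω, c ω * (p ^ (S ω).card)⁻¹ * p ^ (S ω \ U).card ≤ ∑ ω, c ω + U.card * B := by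
  have h : ∀ ω, c ω * (p ^ (S ω).card)⁻¹ * p ^ (S ω \ U).card ≤
      c ω + ∑ i ∈ U, if i ∈ S ω then c ω * (p ^ (S ω).card)⁻¹ else 0 := by
    intro ω
    have hω := hc ω
    have hnn : ∀ i ∈ U, 0 ≤ (if i ∈ S ω then c ω * (p ^ (S ω).card)⁻¹ else 0) := by
      intro i _
      split_ifs <;> positivity
    by_cases hd : ∃ i ∈ U, i ∈ S ω
    · obtain ⟨i, hi, hiS⟩ := hd
      have h2 := Finset.single_le_sum hnn hi
      rw [if_pos hiS] at h2
      have h3 : c ω * (p ^ (S ω).card)⁻¹ * p ^ (S ω \ U).card ≤ c ω * (p ^ (S ω).card)⁻¹ :=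
        mul_le_of_le_one_right (by positivity) (pow_le_one₀ h0.le h1)
      linarith
    · push Not at hd
      have h2 : S ω \ U = S ω := Finset.sdiff_eq_self_of_disjoint
        (Finset.disjoint_left.2 fun i hi hU => hd i hU hi)
      have h3 := Finset.sum_nonneg hnn
      rw [h2, mul_assoc, inv_mul_cancel₀ (by positivity), mul_one]
      linarith
  refine (Finset.sum_le_sum fun ω _ => h ω).trans ?_
  rw [Finset.sum_add_distrib, Finset.sum_comm]
  gcongr
  calc _ ≤ ∑ _i ∈ U, B := Finset.sum_le_sum fun i _ => hB i
    _ = _ := by simp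

/-- Expanding one factor of the power fixes a petal that must be visible, which plants at most l
further coordinates. The remaining factors are then bounded by induction with U enlarged, hence the
general U. -/
theorem sampleMean_petalSum_union_pow_le (h0 : 0 < p) (h1 : p ≤ 1) (hc : ∀ ω, 0 ≤ c ω)
    {B : ℝ} (hB0 : 0 ≤ B) {l : ℕ} (hl : ∀ ω, (S ω).card ≤ l)
    (hB : ∀ i, ∑ ω, (if i ∈ S ω then c ω * (p ^ (S ω).card)⁻¹ else 0) ≤ B)
    (k : ℕ) (U : Finset (Fin n)) :
    sampleMean n p (fun Q => petalSum p c S (Q ∪ U) ^ k) ≤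
      ∏ i ∈ Finset.range k, (∑ ω, c ω + (U.card + i * l : ℕ) * B) := by
  induction k generalizing U with
  | zero => simp [sampleMean_const]
  | succ k ih =>
    have hs : 0 ≤ ∑ ω, c ω := Finset.sum_nonneg fun ω _ => hc ω
    have h : ∀ Q : Finset (Fin n), petalSum p c S (Q ∪ U) ^ (k + 1) =
        ∑ ω, c ω * (p ^ (S ω).card)⁻¹ *
          if S ω \ U ⊆ Q then petalSum p c S (Q ∪ U) ^ k else 0 := by
      intro Q
      rw [pow_succ', petalSum, Finset.sum_mul]
      refine Finset.sum_congr rfl fun ω _ => ?_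
      have : S ω ⊆ Q ∪ U ↔ S ω \ U ⊆ Q := by
        rw [Finset.union_comm]
        exact sdiff_le_iff.symm
      simp only [this]
      split_ifs <;> simp
    simp only [h]
    rw [sampleMean_sum]
    have hstep : ∀ ω, sampleMean n p (fun Q => c ω * (p ^ (S ω).card)⁻¹ *
          if S ω \ U ⊆ Q then petalSum p c S (Q ∪ U) ^ k else 0) ≤
        c ω * (p ^ (S ω).card)⁻¹ * p ^ (S ω \ U).card *
          ∏ i ∈ Finset.range k, (∑ ω, c ω + (U.card + (i + 1) * l : ℕ) * B) := by
      intro ω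
      have hω := hc ω
      rw [sampleMean_const_mul, sampleMean_ite_subset, ← mul_assoc]
      refine mul_le_mul_of_nonneg_left ?_ (by positivity)
      simp only [Finset.union_assoc]
      refine (ih _).trans ?_
      refine Finset.prod_le_prod (fun i _ => by positivity) fun i _ => ?_
      have : (S ω \ U ∪ U).card + i * l ≤ U.card + (i + 1) * l := by
        have := Finset.card_union_le (S ω \ U) U
        have h4 := Finset.card_le_card (Finset.sdiff_subset (s := S ω) (t := U))
        have := hl ω
        nlinarith
      gcongr
    refine (Finset.sum_le_sum fun ω _ => hstep ω).trans ?_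
    rw [← Finset.sum_mul, Finset.prod_range_succ', mul_comm]
    refine mul_le_mul_of_nonneg_left ?_ (Finset.prod_nonneg fun i _ => by positivity)
    simpa using sum_petal_inter_le h0 h1 hc hB U

theorem sampleMean_petalSum_pow_le (h0 : 0 < p) (h1 : p ≤ 1) (hc : ∀ ω, 0 ≤ c ω)
    {B : ℝ} (hB0 : 0 ≤ B) {l : ℕ} (hl : ∀ ω, (S ω).card ≤ l)
    (hB : ∀ i, ∑ ω, (if i ∈ S ω then c ω * (p ^ (S ω).card)⁻¹ else 0) ≤ B) (k : ℕ) :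
    sampleMean n p (fun Q => petalSum p c S Q ^ k) ≤
      ∏ i ∈ Finset.range k, (∑ ω, c ω + (i * l : ℕ) * B) := by
  simpa using sampleMean_petalSum_union_pow_le h0 h1 hc hB0 hl hB k ∅

/-- The upper tail of the estimator, from its `k`-th moment. -/
theorem petalSum_upper_tail (h0 : 0 < p) (h1 : p ≤ 1) (hc : ∀ ω, 0 ≤ c ω)
    {B : ℝ} (hB0 : 0 ≤ B) {l : ℕ} (hl : ∀ ω, (S ω).card ≤ l)
    (hB : ∀ i, ∑ ω, (if i ∈ S ω then c ω * (p ^ (S ω).card)⁻¹ else 0) ≤ B)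
    {τ : ℝ} (hτ : 0 < τ) {k : ℕ} (hμ : ∑ ω, c ω ≤ τ / 4) (hk : k * (l * B) ≤ τ / 4) :
    sampleMean n p (fun Q => if τ < petalSum p c S Q then 1 else 0) ≤ (1 / 2) ^ k := by
  have hs : 0 ≤ ∑ ω, c ω := Finset.sum_nonneg fun ω _ => hc ω
  calc sampleMean n p (fun Q => if τ < petalSum p c S Q then 1 else 0)
      ≤ sampleMean n p (fun Q => (τ ^ k)⁻¹ * petalSum p c S Q ^ k) := by
        refine sampleMean_mono h0.le h1 fun Q => ?_
        have := petalSum_nonneg (S := S) h0 hc Q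
        split_ifs with h
        · rw [inv_mul_eq_div, one_le_div (by positivity)]
          gcongr
        · positivity
    _ ≤ (τ ^ k)⁻¹ * ∏ i ∈ Finset.range k, (∑ ω, c ω + (i * l : ℕ) * B) := by
        rw [sampleMean_const_mul]
        gcongr
        exact sampleMean_petalSum_pow_le h0 h1 hc hB0 hl hB k
    _ ≤ (τ ^ k)⁻¹ * ∏ i ∈ Finset.range k, (τ / 2) := by
        refine mul_le_mul_of_nonneg_left ?_ (by positivity)
        refine Finset.prod_le_prod (fun i _ => by positivity) fun i hi => ?_
        have hik : (i : ℝ) ≤ k := by exact_mod_cast (Finset.mem_range.1 hi).le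
        have : (i : ℝ) * (l * B) ≤ k * (l * B) := by gcongr
        push_cast
        linarith
    _ = (1 / 2) ^ k := by
        rw [Finset.prod_const, Finset.card_range, div_pow, div_pow, one_pow]
        field_simp

/-- The lower tail of the estimator, from its second moment. -/
theorem petalSum_lower_tail (h0 : 0 < p) (h1 : p ≤ 1) (hc : ∀ ω, 0 ≤ c ω)
    {B : ℝ} (hB0 : 0 ≤ B) {l : ℕ} (hl : ∀ ω, (S ω).card ≤ l)
    (hB : ∀ i, ∑ ω, (if i ∈ S ω then c ω * (p ^ (S ω).card)⁻¹ else 0) ≤ B)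
    {τ : ℝ} (hτ : 0 < τ) (hμ : 2 * τ ≤ ∑ ω, c ω) :
    sampleMean n p (fun Q => if τ < petalSum p c S Q then 0 else 1) ≤ 2 * (l * B) / τ := by
  set μ := ∑ ω, c ω with hμd
  have hμ0 : 0 < μ := by linarith
  have hm1 : sampleMean n p (petalSum p c S) = μ := sampleMean_petalSum h0
  have hm2 : sampleMean n p (fun Q => petalSum p c S Q ^ 2) ≤ μ * (μ + l * B) := by
    have := sampleMean_petalSum_pow_le h0 h1 hc hB0 hl hB 2
    simpa [Finset.prod_range_succ] using this
  calc sampleMean n p (fun Q => if τ < petalSum p c S Q then 0 else 1)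
      ≤ sampleMean n p (fun Q => 4 / μ ^ 2 *
          (petalSum p c S Q ^ 2 - 2 * μ * petalSum p c S Q + μ ^ 2)) := by
        refine sampleMean_mono h0.le h1 fun Q => ?_
        -- Chebyshev's inequality: below τ ≤ μ/2 the deviation from the mean is at least μ/2.
        have e : petalSum p c S Q ^ 2 - 2 * μ * petalSum p c S Q + μ ^ 2 =
          (μ - petalSum p c S Q) ^ 2 := by ring
        rw [e]
        split_ifs with h
        · positivity
        · have h3 : μ / 2 ≤ μ - petalSum p c S Q := by linarith
          have h4 : (μ / 2) ^ 2 ≤ (μ - petalSum p c S Q) ^ 2 := by gcongr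
          rw [div_mul_eq_mul_div, one_le_div (by positivity)]
          linarith
    _ ≤ 4 / μ ^ 2 * (μ * (l * B)) := by
        rw [sampleMean_const_mul, sampleMean_add, sampleMean_sub, sampleMean_const_mul,
          sampleMean_const, hm1]
        gcongr
        linarith
    _ = 4 * (l * B) / μ := by field_simp
    _ ≤ 4 * (l * B) / (2 * τ) := by gcongr
    _ = _ := by field_simp; ring

end petalSum

/-! ### From decision rules to sample-based algorithms -/

/-- A decision rule that reads the input only inside the sample gives a sample-based
algorithm. -/
theorem exists_sampleAlg {α : Type u} {n : ℕ} {p : ℝ} (h0 : 0 ≤ p) (h1 : p ≤ 1) (cap : ℕ)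
    (A : Finset (Fin n) → (Fin n → α) → Prop)
    (hA : ∀ Q x y, (∀ i ∈ Q, x i = y i) → A Q x → A Q y) :
    ∃ S : SampleAlg α n, S.cap = cap ∧ ∀ x, ∀ b : Bool, ∀ δ : ℝ,
      (open Classical in sampleMean n p (fun Q => if decide (A Q x) = b then 0 else 1) ≤ δ) →
      1 - δ - sampleMean n p (fun Q => if Q.card ≤ cap then 0 else 1) ≤ (S.run x b).toReal := by
  classical
  -- Only the restriction to Q is available, so the rule is applied to any string extending it; by
  -- `hA` the choice does not matter.
  let S : SampleAlg α n := ⟨⟨p, h0⟩, h1, cap, fun Q f => PMF.pure (decide (∃ x : Fin n → α,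
    (∀ i (h : i ∈ Q), x i = f i h) ∧ A Q x)), fun _ => PMF.pure true⟩
  refine ⟨S, rfl, fun x b δ hδ => ?_⟩
  have hrun : (S.run x b).toReal = sampleMean n p (fun Q =>
      ((if Q.card ≤ cap then S.decision Q (fun i _ => x i) else S.overflow Q) b).toReal) := by
    simp only [SampleAlg.run]
    rw [PMF.bind_apply, tsum_fintype, ENNReal.toReal_sum]
    · refine Finset.sum_congr rfl fun Q _ => ?_
      rw [ENNReal.toReal_mul]
      congr 1
      simp only [sampleSet, PMF.ofFintype_apply, ENNReal.coe_toReal, NNReal.coe_mul,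
        NNReal.coe_pow]
      rw [NNReal.coe_sub S.prob_le_one]
      rfl
    · intro Q _
      exact ENNReal.mul_ne_top (PMF.apply_ne_top _ _) (PMF.apply_ne_top _ _)
  have hdec : ∀ Q, S.decision Q (fun i _ => x i) = PMF.pure (decide (A Q x)) := by
    intro Q
    change PMF.pure (decide _) = _
    congr 1
    rw [decide_eq_decide]
    refine ⟨?_, fun h => ⟨x, fun _ _ => rfl, h⟩⟩
    rintro ⟨y, hy, h⟩
    exact hA Q y x hy h
  rw [hrun]
  have key : sampleMean n p (fun Q => 1 - (if decide (A Q x) = b then (0 : ℝ) else 1) -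
      if Q.card ≤ cap then (0 : ℝ) else 1) ≤ sampleMean n p (fun Q =>
      ((if Q.card ≤ cap then S.decision Q (fun i _ => x i) else S.overflow Q) b).toReal) := by
    refine sampleMean_mono h0 h1 fun Q => ?_
    by_cases hQ : Q.card ≤ cap
    · rw [if_pos hQ, if_pos hQ, hdec]
      by_cases hb : decide (A Q x) = b
      · simp [hb]
      · rw [if_neg hb]
        refine le_trans ?_ ENNReal.toReal_nonneg
        norm_num
    · refine le_trans ?_ ENNReal.toReal_nonneg
      rw [if_neg hQ]
      split_ifs <;> norm_num
  rw [sampleMean_sub, sampleMean_sub, sampleMean_const] at key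
  linarith

/-! ### Query algorithms as finite families of local maps -/

namespace DecisionTree

/-- The set of coordinates that the tree queries on input `x`. -/
def queried {α : Type u} {n : ℕ} : DecisionTree α n → (Fin n → α) → Finset (Fin n)
  | leaf _, _ => ∅
  | query i next, x => insert i ((next (x i)).queried x)

variable {α : Type u} {n : ℕ}

theorem card_queried_le (T : DecisionTree α n) (x : Fin n → α) :
    (T.queried x).card ≤ T.numQueries x := by
  induction T with
  | leaf b => simp [queried]
  | query i next ih =>
    exact (Finset.card_insert_le _ _).trans (Nat.succ_le_succ (ih (x i)))

theorem queried_output_congr (T : DecisionTree α n) {x y : Fin n → α}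
    (h : ∀ i ∈ T.queried x, x i = y i) :
    T.queried x = T.queried y ∧ T.output x = T.output y := by
  induction T with
  | leaf b => exact ⟨rfl, rfl⟩
  | query i next ih =>
    have hi : x i = y i := h i (Finset.mem_insert_self _ _)
    obtain ⟨h1, h2⟩ := ih (x i) fun j hj => h j (Finset.mem_insert_of_mem hj)
    simp only [queried, output, h1, h2, ← hi, and_self]

end DecisionTree

/-- A deterministic algorithm seen as a function: on each input the set of coordinates that it
queries, at most `q` many, and its output, both determined by the queried coordinates. -/
def IsLocalMap {α : Type u} {n : ℕ} (q : ℕ) (f : (Fin n → α) → Finset (Fin n) × Bool) : Prop :=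
  ∀ x, (f x).1.card ≤ q ∧ ∀ y, (∀ i ∈ (f x).1, x i = y i) → f x = f y

/-- A finite randomised query algorithm that makes at most `l` queries. -/
structure QueryFamily (α : Type u) (n : ℕ) (Ω : Type u) [Fintype Ω] (l : ℕ) where
  weight : Ω → ℝ
  weight_nonneg : ∀ ω, 0 ≤ weight ω
  sum_weight : ∑ ω, weight ω = 1
  alg : Ω → (Fin n → α) → Finset (Fin n) × Bool
  isLocalMap : ∀ ω, IsLocalMap l (alg ω)

namespace QueryFamily

variable {α : Type u} {n : ℕ} {Ω : Type u} [Fintype Ω] {l : ℕ}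

/-- The probability that the output on `x` is `true`. -/
noncomputable def acceptProb (F : QueryFamily α n Ω l) (x : Fin n → α) : ℝ :=
  ∑ ω, if (F.alg ω x).2 = true then F.weight ω else 0

/-- The set of coordinates queried on input `x`. -/
def queries (F : QueryFamily α n Ω l) (ω : Ω) (x : Fin n → α) : Finset (Fin n) :=
  (F.alg ω x).1

theorem card_queries_le (F : QueryFamily α n Ω l) (ω : Ω) (x : Fin n → α) :
    (F.queries ω x).card ≤ l :=
  (F.isLocalMap ω x).1

theorem alg_congr (F : QueryFamily α n Ω l) (ω : Ω) {x y : Fin n → α}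
    (h : ∀ i ∈ F.queries ω x, x i = y i) : F.alg ω x = F.alg ω y :=
  (F.isLocalMap ω x).2 y h

theorem queries_congr (F : QueryFamily α n Ω l) (ω : Ω) {x y : Fin n → α}
    (h : ∀ i ∈ F.queries ω x, x i = y i) : F.queries ω x = F.queries ω y :=
  congrArg Prod.fst (F.alg_congr ω h)

end QueryFamily

section ofQueryAlg

variable {α : Type u} {n : ℕ}

open Classical in
/-- The local map of a tree with at most `q` queries, and a trivial map for other trees. -/
noncomputable def DecisionTree.toLocalMap (q : ℕ) (T : DecisionTree α n) :
    {f : (Fin n → α) → Finset (Fin n) × Bool // IsLocalMap q f} :=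
  if h : ∀ x, T.numQueries x ≤ q then
    ⟨fun x => (T.queried x, T.output x), fun x => ⟨(T.card_queried_le x).trans (h x),
      fun _ hy => Prod.ext (T.queried_output_congr hy).1 (T.queried_output_congr hy).2⟩⟩
  else ⟨fun _ => (∅, false), fun _ => ⟨by simp, fun _ _ => rfl⟩⟩

/-- There may be infinitely many trees, but acceptance depends only on the induced local map.
Pushing the coin tosses forward to the finite type of such maps turns probabilities into finite
sums. -/
theorem exists_queryFamily {q : ℕ}
    [Fintype {f : (Fin n → α) → Finset (Fin n) × Bool // IsLocalMap q f}]
    (M : QueryAlg α n) (hM : M.QueryBound q) :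
    ∃ F : QueryFamily α n {f : (Fin n → α) → Finset (Fin n) × Bool // IsLocalMap q f} q, ∀ x, F.acceptProb x = (M.run x true).toReal := by
  classical
  let Ω := {f : (Fin n → α) → Finset (Fin n) × Bool // IsLocalMap q f}
  let ν : PMF Ω := M.map fun T => T.toLocalMap q
  have hν : ∑ ω, (ν ω).toReal = 1 := by
    rw [← ENNReal.toReal_sum fun _ _ => PMF.apply_ne_top _ _,
      ← tsum_fintype (L := .unconditional Ω), PMF.tsum_coe, ENNReal.toReal_one]
  refine ⟨⟨fun ω => (ν ω).toReal, fun _ => ENNReal.toReal_nonneg, hν, fun ω => ω.1,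
    fun ω => ω.2⟩, fun x => ?_⟩
  · have h : M.run x = ν.map fun ω => (ω.1 x).2 := by
      rw [PMF.map_comp]
      ext b
      simp only [QueryAlg.run, PMF.map_apply]
      refine tsum_congr fun T => ?_
      by_cases hT : M T = 0
      · simp [hT]
      · have hq := hM T ((PMF.mem_support_iff _ _).2 hT)
        simp [DecisionTree.toLocalMap, hq]
    rw [h, PMF.map_apply, tsum_fintype (L := .unconditional Ω), ENNReal.toReal_sum]
    · refine Finset.sum_congr rfl fun ω _ => ?_
      simp only [eq_comm (a := true)]
      split_ifs <;> rfl
    · intro ω _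
      split_ifs
      · exact PMF.apply_ne_top _ _
      · simp

end ofQueryAlg

/-! ### Amplification by majority vote -/

section amplify

/-- If a trial is bad with probability at most `1 / 3`, then at least half of `2 * k` independent
trials are bad with probability at most `(8 / 9) ^ k`. -/
theorem sum_prod_weight_le {Ω : Type*} [Fintype Ω] {w : Ω → ℝ} (h0 : ∀ ω, 0 ≤ w ω)
    (h1 : ∑ ω, w ω = 1) (bad : Ω → Prop) [DecidablePred bad]
    (hbad : ∑ ω, (if bad ω then w ω else 0) ≤ 1 / 3) (k : ℕ) :
    ∑ v : Fin (2 * k) → Ω, (if k ≤ (Finset.univ.filter fun i => bad (v i)).card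
      then ∏ i, w (v i) else 0) ≤ (8 / 9) ^ k := by
  have hsum : ∑ ω, (if bad ω then 2 else 1) * w ω ≤ 4 / 3 := by
    have : ∀ ω, (if bad ω then 2 else 1) * w ω = w ω + if bad ω then w ω else 0 := by
      intro ω; split_ifs <;> ring
    simp only [this, Finset.sum_add_distrib, h1]
    linarith
  have hnn : ∀ ω, 0 ≤ (if bad ω then 2 else 1) * w ω := by
    intro ω
    have := h0 ω
    split_ifs <;> positivity
  -- Markov's inequality for 2 to the number of bad trials. Each trial contributes a factor at most
  -- 4/3, and (4/3)²/2 = 8/9.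
  calc _ ≤ ∑ v : Fin (2 * k) → Ω, (1 / 2) ^ k *
        ∏ i, ((if bad (v i) then 2 else 1) * w (v i)) := by
        refine Finset.sum_le_sum fun v _ => ?_
        have hw : 0 ≤ ∏ i, w (v i) := Finset.prod_nonneg fun i _ => h0 _
        rw [Finset.prod_mul_distrib, ← mul_assoc]
        split_ifs with h
        · refine le_mul_of_one_le_left hw ?_
          rw [Finset.prod_ite, Finset.prod_const, Finset.prod_const, one_pow, mul_one]
          calc (1 : ℝ) = (1 / 2) ^ k * 2 ^ k := by rw [← mul_pow]; norm_num
            _ ≤ _ := by gcongr; norm_num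
        · refine mul_nonneg (mul_nonneg (by positivity) (Finset.prod_nonneg fun i _ => ?_)) hw
          split_ifs <;> norm_num
    _ = (1 / 2) ^ k * (∑ ω, (if bad ω then 2 else 1) * w ω) ^ (2 * k) := by
        rw [← Finset.mul_sum, Finset.sum_pow', Fintype.piFinset_univ]
    _ ≤ (1 / 2) ^ k * (4 / 3) ^ (2 * k) := by
        have := Finset.sum_nonneg fun ω (_ : ω ∈ Finset.univ) => hnn ω
        gcongr
    _ = (8 / 9) ^ k := by
        rw [pow_mul, ← mul_pow]; norm_num

variable {α : Type u} {n : ℕ} {Ω : Type u} [Fintype Ω] {l : ℕ}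

/-- The majority vote of `2 * k` independent runs, a tie being decided for `true`. -/
noncomputable def QueryFamily.amplify (F : QueryFamily α n Ω l) (k : ℕ) :
    QueryFamily α n (Fin (2 * k) → Ω) (2 * k * l) where
  weight v := ∏ i, F.weight (v i)
  weight_nonneg v := Finset.prod_nonneg fun i _ => F.weight_nonneg _
  sum_weight := by
    rw [← Fintype.piFinset_univ, ← Finset.sum_pow', F.sum_weight, one_pow]
  alg v x := (Finset.univ.biUnion fun i => F.queries (v i) x,
    decide (k ≤ (Finset.univ.filter fun i => (F.alg (v i) x).2 = true).card))
  isLocalMap v x := by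
    refine ⟨?_, fun y hy => ?_⟩
    · refine (Finset.card_biUnion_le_card_mul _ _ l fun i _ => F.card_queries_le _ _).trans ?_
      simp
    · have h : ∀ i, F.alg (v i) x = F.alg (v i) y := fun i => F.alg_congr _ fun j hj =>
        hy j (Finset.mem_biUnion.2 ⟨i, Finset.mem_univ _, hj⟩)
      simp only [QueryFamily.queries, h]

theorem QueryFamily.acceptProb_amplify_le (F : QueryFamily α n Ω l) (k : ℕ) (x : Fin n → α)
    (h : F.acceptProb x ≤ 1 / 3) : (F.amplify k).acceptProb x ≤ (8 / 9) ^ k := by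
  simpa [acceptProb, amplify] using
    sum_prod_weight_le F.weight_nonneg F.sum_weight (fun ω => (F.alg ω x).2 = true) h k

theorem QueryFamily.le_acceptProb_amplify (F : QueryFamily α n Ω l) (k : ℕ) (x : Fin n → α)
    (h : 2 / 3 ≤ F.acceptProb x) : 1 - (8 / 9) ^ k ≤ (F.amplify k).acceptProb x := by
  have hc : ∀ {Ω : Type u} [Fintype Ω] {l : ℕ} (F : QueryFamily α n Ω l),
      ∑ ω, (if (F.alg ω x).2 ≠ true then F.weight ω else 0) = 1 - F.acceptProb x := by
    intro Ω _ l F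
    rw [← F.sum_weight, acceptProb, ← Finset.sum_sub_distrib]
    refine Finset.sum_congr rfl fun ω _ => ?_
    by_cases hω : (F.alg ω x).2 = true <;> simp [hω]
  have h1 := sum_prod_weight_le F.weight_nonneg F.sum_weight (fun ω => (F.alg ω x).2 ≠ true)
    (by rw [hc]; linarith) k
  have h2 := hc (F.amplify k)
  have h3 : ∑ v, (if ((F.amplify k).alg v x).2 ≠ true then (F.amplify k).weight v else 0) ≤
      (8 / 9) ^ k := by
    refine le_trans (Finset.sum_le_sum fun v _ => ?_) h1
    have hw := (F.amplify k).weight_nonneg v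
    have hcard := Finset.card_filter_add_card_filter_not (s := Finset.univ)
      (fun i : Fin (2 * k) => (F.alg (v i) x).2 = true)
    rw [Finset.card_univ, Fintype.card_fin] at hcard
    by_cases hv : k ≤ (Finset.univ.filter fun i => (F.alg (v i) x).2 ≠ true).card
    · rw [if_pos hv]
      split_ifs
      · exact le_rfl
      · exact hw
    · have hv' : ((F.amplify k).alg v x).2 = true := by
        simp only [amplify, decide_eq_true_eq]
        simp only [ne_eq] at hv
        omega
      rw [if_neg hv, if_neg (not_not.2 hv')]
  linarith

end amplify

/-! ### Influence of coordinates -/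

namespace QueryFamily

variable {α : Type u} [Fintype α] {n : ℕ} {Ω : Type u} [Fintype Ω] {l : ℕ}

open Classical in
/-- The probability that coordinate `i` is queried on a uniformly random input. -/
noncomputable def influence (F : QueryFamily α n Ω l) (i : Fin n) : ℝ :=
  ∑ ω, F.weight ω * ((Finset.univ.filter fun x => i ∈ F.queries ω x).card /
    (Fintype.card α : ℝ) ^ n)

theorem influence_nonneg (F : QueryFamily α n Ω l) (i : Fin n) : 0 ≤ F.influence i :=
  Finset.sum_nonneg fun ω _ => mul_nonneg (F.weight_nonneg ω) (by positivity)

theorem sum_influence_le [Nonempty α] (F : QueryFamily α n Ω l) :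
    ∑ i, F.influence i ≤ l := by
  classical
  have hcard : (0 : ℝ) < (Fintype.card α : ℝ) ^ n := by
    have := Fintype.card_pos (α := α)
    positivity
  simp only [influence]
  rw [Finset.sum_comm]
  have h : ∀ ω, ∑ i, F.weight ω * (((Finset.univ.filter fun x => i ∈ F.queries ω x).card : ℝ) /
      (Fintype.card α : ℝ) ^ n) ≤ F.weight ω * l := by
    intro ω
    rw [← Finset.mul_sum, ← Finset.sum_div]
    refine mul_le_mul_of_nonneg_left ?_ (F.weight_nonneg ω)
    rw [div_le_iff₀ hcard]
    have h1 : ∑ i, (Finset.univ.filter fun x => i ∈ F.queries ω x).card =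
        ∑ x, (F.queries ω x).card := by
      have := Finset.sum_card_bipartiteAbove_eq_sum_card_bipartiteBelow
        (s := (Finset.univ : Finset (Fin n))) (t := (Finset.univ : Finset (Fin n → α)))
        (fun i x => i ∈ F.queries ω x)
      simpa [Finset.bipartiteAbove, Finset.bipartiteBelow] using this
    have h2 : ∑ x, (F.queries ω x).card ≤ l * Fintype.card α ^ n := by
      calc _ ≤ ∑ _x : Fin n → α, l := Finset.sum_le_sum fun x _ => F.card_queries_le ω x
        _ = _ := by simp [mul_comm]
    rw [← h1] at h2
    exact_mod_cast h2
  refine (Finset.sum_le_sum fun ω _ => h ω).trans ?_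
  rw [← Finset.sum_mul, F.sum_weight, one_mul]

theorem card_le_mul_card_agree (S : Finset (Fin n)) (y : Fin n → α) (hS : S.card ≤ l)
    [Nonempty α] [DecidablePred fun x : Fin n → α => ∀ i ∈ S, y i = x i] :
    Fintype.card α ^ n ≤
      Fintype.card α ^ l * (Finset.univ.filter fun x : Fin n → α => ∀ i ∈ S, y i = x i).card := by
  classical
  have hpos := Fintype.card_pos (α := α)
  have h : (Finset.univ.filter fun x : Fin n → α => ∀ i ∈ S, y i = x i) =
      Fintype.piFinset fun i => if i ∈ S then {y i} else Finset.univ := by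
    ext x
    simp only [Finset.mem_filter, Finset.mem_univ, true_and, Fintype.mem_piFinset]
    refine forall_congr' fun i => ?_
    by_cases hi : i ∈ S <;> simp [hi, eq_comm]
  have h2 : (Finset.univ.filter fun x : Fin n → α => ∀ i ∈ S, y i = x i).card =
      Fintype.card α ^ (n - S.card) := by
    rw [h, Fintype.card_piFinset]
    have : ∀ i, (if i ∈ S then {y i} else (Finset.univ : Finset α)).card =
        if i ∈ S then 1 else Fintype.card α := by
      intro i; split_ifs <;> simp
    simp only [this]
    rw [Finset.prod_ite, Finset.prod_const, Finset.prod_const, one_pow, one_mul,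
      Finset.filter_not, Finset.filter_mem_eq_inter, Finset.univ_inter,
      Finset.card_sdiff_of_subset (Finset.subset_univ _), Finset.card_univ, Fintype.card_fin]
  rw [h2, ← pow_add]
  exact Nat.pow_le_pow_right hpos (by omega)

open Classical in
/-- On a fixed input a coordinate is queried with probability not much larger than on a random
input. -/
theorem sum_weight_mem_queries_le [Nonempty α] (F : QueryFamily α n Ω l) (y : Fin n → α)
    (i : Fin n) :
    ∑ ω, (if i ∈ F.queries ω y then F.weight ω else 0) ≤
      (Fintype.card α : ℝ) ^ l * F.influence i := by
  have hpos : 0 < Fintype.card α := Fintype.card_pos (α := α)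
  rw [influence, Finset.mul_sum]
  refine Finset.sum_le_sum fun ω _ => ?_
  have hw := F.weight_nonneg ω
  split_ifs with h
  · rw [mul_left_comm]
    refine le_mul_of_one_le_right hw ?_
    rw [← mul_div_assoc, one_le_div (by positivity)]
    -- If ω queries i on y, it does so on every string agreeing with y on the queried set; these are
    -- at least a |α|^(-l) fraction of all strings.
    have h1 := card_le_mul_card_agree (F.queries ω y) y (F.card_queries_le ω y)
    refine le_trans (by exact_mod_cast h1) (b := (Fintype.card α : ℝ) ^ l *
      (Finset.univ.filter fun x : Fin n → α => ∀ j ∈ F.queries ω y, y j = x j).card) ?_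
    gcongr with x
    intro hx
    rw [← F.queries_congr ω hx]
    exact h
  · positivity

end QueryFamily

/-! ### Estimates with a kernel, and influence levels -/

namespace QueryFamily

variable {α : Type u} {n : ℕ} {Ω : Type u} [Fintype Ω] {l : ℕ}

open Classical in
/-- The weight of `ω` if it accepts `y` and queries only coordinates in `R`, and otherwise `0`. -/
noncomputable def acceptWeight (F : QueryFamily α n Ω l) (R : Finset (Fin n)) (y : Fin n → α)
    (ω : Ω) : ℝ :=
  if (F.alg ω y).2 = true ∧ F.queries ω y ⊆ R then F.weight ω else 0

theorem acceptWeight_nonneg (F : QueryFamily α n Ω l) (R : Finset (Fin n)) (y : Fin n → α)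
    (ω : Ω) : 0 ≤ F.acceptWeight R y ω := by
  have := F.weight_nonneg ω
  rw [acceptWeight]
  split_ifs <;> simp [this]

theorem acceptWeight_le_weight (F : QueryFamily α n Ω l) (R : Finset (Fin n)) (y : Fin n → α)
    (ω : Ω) : F.acceptWeight R y ω ≤ F.weight ω := by
  have := F.weight_nonneg ω
  rw [acceptWeight]
  split_ifs <;> simp [this]

theorem sum_acceptWeight_le (F : QueryFamily α n Ω l) (R : Finset (Fin n)) (y : Fin n → α) :
    ∑ ω, F.acceptWeight R y ω ≤ F.acceptProb y := by
  refine Finset.sum_le_sum fun ω _ => ?_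
  have := F.weight_nonneg ω
  rw [acceptWeight]
  split_ifs with h1 h2
  · exact le_rfl
  · exact absurd h1.1 h2
  · exact this
  · exact le_rfl

/-- The estimate, from the sample `Q`, for the probability that `y` is accepted by queries
inside `H ∪ L`, where the kernel `H` does not have to be sampled. -/
noncomputable def estimate (F : QueryFamily α n Ω l) (p : ℝ) (H L : Finset (Fin n))
    (y : Fin n → α) (Q : Finset (Fin n)) : ℝ :=
  petalSum p (F.acceptWeight (H ∪ L) y) (fun ω => F.queries ω y \ H) Q

/-- A run contributes only if all its queries lie in H ∪ Q, and such a run is identical on y and z.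
Visibility has to be transferred in both directions. -/
theorem estimate_congr (F : QueryFamily α n Ω l) (p : ℝ) (H L Q : Finset (Fin n))
    {y z : Fin n → α} (h : ∀ i ∈ H ∪ Q, y i = z i) :
    F.estimate p H L y Q = F.estimate p H L z Q := by
  refine Finset.sum_congr rfl fun ω _ => ?_
  have key : ∀ {y z : Fin n → α}, (∀ i ∈ H ∪ Q, y i = z i) → F.queries ω y \ H ⊆ Q →
      F.queries ω y = F.queries ω z ∧
        F.acceptWeight (H ∪ L) y ω = F.acceptWeight (H ∪ L) z ω := by
    intro y z h hy
    have hyz : F.alg ω y = F.alg ω z :=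
      F.alg_congr ω fun i hi => h i (sdiff_le_iff.1 hy hi)
    exact ⟨congrArg Prod.fst hyz, if_congr (by rw [queries, queries, hyz]) rfl rfl⟩
  by_cases hy : F.queries ω y \ H ⊆ Q
  · obtain ⟨h1, h2⟩ := key h hy
    have hz : F.queries ω z \ H ⊆ Q := h1 ▸ hy
    simp only [if_pos hz, h2, h1]
  by_cases hz : F.queries ω z \ H ⊆ Q
  · obtain ⟨h1, -⟩ := key (fun i hi => (h i hi).symm) hz
    exact absurd (h1 ▸ hz : F.queries ω y \ H ⊆ Q) hy
  rw [if_neg hy, if_neg hz]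

/-- A counted coordinate outside H must be light, so on any input it is queried with probability at
most |α|^l t. A petal containing it is nonempty, so its sampling probability retains at least one
factor M. This factor later cancels the proof length and makes the sample complexity linear in m. -/
theorem sum_petal_weight_le [Fintype α] [Nonempty α] (F : QueryFamily α n Ω l)
    {M p₀ t : ℝ} (hM : 1 ≤ M) (hp₀ : 0 < p₀) (hp₁ : p₀ ≤ 1) {H L : Finset (Fin n)}
    (hL : ∀ i ∈ L, F.influence i ≤ t) (ht : 0 ≤ t) (y : Fin n → α) (i : Fin n) :
    ∑ ω, (if i ∈ F.queries ω y \ H then F.acceptWeight (H ∪ L) y ω *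
      ((M * p₀) ^ (F.queries ω y \ H).card)⁻¹ else 0) ≤
      (Fintype.card α : ℝ) ^ l * t / (M * p₀ ^ l) := by
  classical
  by_cases hi : i ∈ L
  · have hmul : (Fintype.card α : ℝ) ^ l * F.influence i ≤ (Fintype.card α : ℝ) ^ l * t := by
      have := hL i hi
      gcongr
    have h := (F.sum_weight_mem_queries_le y i).trans hmul
    rw [div_eq_mul_inv]
    refine le_trans ?_ (mul_le_mul_of_nonneg_right h (by positivity))
    rw [Finset.sum_mul]
    refine Finset.sum_le_sum fun ω _ => ?_
    have hw := F.weight_nonneg ω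
    by_cases hiS : i ∈ F.queries ω y \ H
    · rw [if_pos hiS, if_pos (Finset.mem_sdiff.1 hiS).1]
      have hc : 1 ≤ (F.queries ω y \ H).card := Finset.card_pos.2 ⟨i, hiS⟩
      have hc' : (F.queries ω y \ H).card ≤ l :=
        (Finset.card_le_card Finset.sdiff_subset).trans (F.card_queries_le ω y)
      have hpow : M * p₀ ^ l ≤ (M * p₀) ^ (F.queries ω y \ H).card := by
        rw [mul_pow]
        have h1 := le_self_pow₀ hM (n := (F.queries ω y \ H).card) (by omega)
        have h2 := pow_le_pow_of_le_one hp₀.le hp₁ hc'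
        gcongr
      have := F.acceptWeight_le_weight (H ∪ L) y ω
      gcongr
    · rw [if_neg hiS]
      split_ifs <;> positivity
  · refine le_trans (Finset.sum_nonpos fun ω _ => ?_) (by positivity)
    split_ifs with hiS
    · have : ¬ F.queries ω y ⊆ H ∪ L := fun hsub => by
        rw [Finset.mem_sdiff] at hiS
        rcases Finset.mem_union.1 (hsub hiS.1) with h | h
        · exact hiS.2 h
        · exact hi h
      simp [acceptWeight, this]
    · exact le_rfl

section levels

variable [Fintype α]

/-- The coordinates of influence at least `t`. -/
noncomputable def heavy (F : QueryFamily α n Ω l) (t : ℝ) : Finset (Fin n) :=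
  Finset.univ.filter fun i => t ≤ F.influence i

/-- The coordinates of influence less than `t`. -/
noncomputable def light (F : QueryFamily α n Ω l) (t : ℝ) : Finset (Fin n) :=
  Finset.univ.filter fun i => F.influence i < t

theorem card_heavy_mul_le [Nonempty α] (F : QueryFamily α n Ω l) (t : ℝ) :
    (F.heavy t).card * t ≤ l := by
  calc ((F.heavy t).card : ℝ) * t = ∑ _i ∈ F.heavy t, t := by simp
    _ ≤ ∑ i ∈ F.heavy t, F.influence i :=
        Finset.sum_le_sum fun i hi => (Finset.mem_filter.1 hi).2
    _ ≤ ∑ i, F.influence i :=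
        Finset.sum_le_univ_sum_of_nonneg F.influence_nonneg
    _ ≤ l := F.sum_influence_le

/-- Among `l + 1` intervals one contains no influence of the at most `l` queried coordinates. -/
theorem exists_queries_subset (F : QueryFamily α n Ω l) {t : ℕ → ℝ} (ht : Monotone t)
    (ω : Ω) (y : Fin n → α) :
    ∃ j ∈ Finset.range (l + 1), F.queries ω y ⊆ F.heavy (t (j + 1)) ∪ F.light (t j) := by
  by_contra! hne
  have h : ∀ j : ℕ, ∃ i, j ∈ Finset.range (l + 1) →
      i ∈ F.queries ω y ∧ t j ≤ F.influence i ∧ F.influence i < t (j + 1) := by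
    intro j
    by_cases hj : j ∈ Finset.range (l + 1)
    · obtain ⟨i, hi, hi'⟩ := Finset.not_subset.1 (hne j hj)
      simp only [heavy, light, Finset.mem_union, Finset.mem_filter, Finset.mem_univ, true_and,
        not_or, not_le, not_lt] at hi'
      exact ⟨i, fun _ => ⟨hi, hi'.2, hi'.1⟩⟩
    -- Beyond the range the value is arbitrary; the failure at level 0 provides some coordinate.
    · obtain ⟨i, -, -⟩ := Finset.not_subset.1 (hne 0 (by simp))
      exact ⟨i, fun h => absurd h hj⟩
  choose f hf using h
  -- The intervals are disjoint, so a queried coordinate in each would give l + 1 distinct queries.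
  have hinj : Set.InjOn f (Finset.range (l + 1) : Set ℕ) := by
    intro a ha b hb hab
    obtain ⟨-, ha1, ha2⟩ := hf a ha
    obtain ⟨-, hb1, hb2⟩ := hf b hb
    rw [hab] at ha1 ha2
    by_contra hne
    rcases Nat.lt_or_gt_of_ne hne with hlt | hlt
    · have := ht (Nat.succ_le_of_lt hlt)
      simp only [Nat.succ_eq_add_one] at this
      linarith
    · have := ht (Nat.succ_le_of_lt hlt)
      simp only [Nat.succ_eq_add_one] at this
      linarith
  have hcard := Finset.card_le_card_of_injOn f (fun j hj => (hf j hj).1) hinj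
  have := F.card_queries_le ω y
  rw [Finset.card_range] at hcard
  omega

/-- Every accepting run is counted at some level, so the level sums together dominate the acceptance
probability; one of them reaches the average. -/
theorem exists_le_sum_acceptWeight (F : QueryFamily α n Ω l) {t : ℕ → ℝ} (ht : Monotone t)
    (y : Fin n → α) :
    ∃ j ∈ Finset.range (l + 1), F.acceptProb y / (l + 1) ≤
      ∑ ω, F.acceptWeight (F.heavy (t (j + 1)) ∪ F.light (t j)) y ω := by
  have h : F.acceptProb y ≤ ∑ j ∈ Finset.range (l + 1),
      ∑ ω, F.acceptWeight (F.heavy (t (j + 1)) ∪ F.light (t j)) y ω := by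
    rw [Finset.sum_comm]
    refine Finset.sum_le_sum fun ω _ => ?_
    have hnn : ∀ j ∈ Finset.range (l + 1),
        0 ≤ F.acceptWeight (F.heavy (t (j + 1)) ∪ F.light (t j)) y ω :=
      fun j _ => F.acceptWeight_nonneg _ y ω
    split_ifs with hω
    · obtain ⟨j, hj, hsub⟩ := F.exists_queries_subset ht ω y
      refine le_trans ?_ (Finset.single_le_sum hnn hj)
      rw [acceptWeight, if_pos ⟨hω, hsub⟩]
    · exact Finset.sum_nonneg hnn
  refine Finset.exists_le_of_sum_le (Finset.nonempty_range_add_one) ?_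
  rw [Finset.sum_const, Finset.card_range, nsmul_eq_mul]
  push_cast
  rw [mul_div_cancel₀ _ (by positivity)]
  exact h

end levels

end QueryFamily

/-! ### The tester with free parameters -/

/-- The string `x` with its restriction to `H` replaced by `κ`. -/
def overwrite {α : Type u} {n : ℕ} (H : Finset (Fin n)) (x : Fin n → α) (κ : H → α) :
    Fin n → α :=
  fun i => if h : i ∈ H then κ ⟨i, h⟩ else x i

theorem overwrite_restrict {α : Type u} {n : ℕ} (H : Finset (Fin n)) (x : Fin n → α) :
    overwrite H x (fun i => x i) = x := by
  funext i
  simp [overwrite]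

theorem hammingDist_overwrite_le {α : Type u} [DecidableEq α] {n : ℕ} (H : Finset (Fin n))
    (x : Fin n → α) (κ : H → α) : hammingDist x (overwrite H x κ) ≤ H.card := by
  refine Finset.card_le_card fun i hi => ?_
  by_contra h
  simp [overwrite, h] at hi

/-- The triangle inequality. Soundness at parameter ε/2 thus still applies after a wrong guess of
the kernel, which is why the proximity parameter is halved. -/
theorem IsFar.overwrite {α : Type u} [DecidableEq α] {n : ℕ} {ε : ℝ} {x : Fin n → α}
    {P : Set (Fin n → α)} (hx : IsFar ε x P) (hn : 0 < n) {H : Finset (Fin n)}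
    (hH : (H.card : ℝ) ≤ ε / 2 * n) (κ : H → α) : IsFar (ε / 2) (overwrite H x κ) P := by
  intro z hz
  have h := hx z hz
  have hn' : (0 : ℝ) < n := by exact_mod_cast hn
  rw [lt_div_iff₀ hn'] at h ⊢
  have h1 : (hammingDist x z : ℝ) ≤ H.card + hammingDist (LocalTest.overwrite H x κ) z := by
    exact_mod_cast (hammingDist_triangle x (LocalTest.overwrite H x κ) z).trans
      (Nat.add_le_add_right (hammingDist_overwrite_le H x κ) _)
  linarith

/-- A family of query algorithms, indexed by proofs, whose soundness error is small compared with
the number of queries gives a sample-based tester. The threshold `t j` separates the light from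
the heavy coordinates, `K j` bounds the size of the kernels of level `j`, and `k j` is the order
of the moment that is used at that level. -/
theorem exists_isTester_of_queryFamily {α : Type u} [Fintype α] [Nonempty α] [DecidableEq α]
    {n m l : ℕ} (hn : 0 < n) {Ω : Type u} [Fintype Ω] (F : (Fin m → α) → QueryFamily α n Ω l)
    {P : Set (Fin n → α)} {ε : ℝ}
    (hcomplete : ∀ x ∈ P, ∃ w, 1 / 2 ≤ (F w).acceptProb x)
    (hsound : ∀ x, IsFar (ε / 2) x P → ∀ w, (F w).acceptProb x ≤ 1 / (16 * (l + 1)))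
    {M p₀ : ℝ} (hM : 1 ≤ M) (hp₀ : 0 < p₀) (hp₁ : p₀ ≤ 1) (hp : M * p₀ ≤ 1)
    {t : ℕ → ℝ} (ht : Monotone t) (ht0 : ∀ j, 0 < t j) (K k : ℕ → ℕ) {cap : ℕ}
    (hK : ∀ j ≤ l, l / t (j + 1) < K j + 1) (hKε : ∀ j ≤ l, (K j : ℝ) ≤ ε / 2 * n)
    (hk5 : ∀ j ≤ l, 5 ≤ k j)
    (hk : ∀ j ≤ l, k j * (l * ((Fintype.card α : ℝ) ^ l * t j / (M * p₀ ^ l))) ≤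
      1 / (16 * (l + 1)))
    (hkK : ∀ j ≤ l, 10 * (l + 1) * Fintype.card α ^ (m + K j) ≤ 2 ^ k j)
    (hcap : 10 * (n * (M * p₀)) ≤ cap + 1) :
    ∃ S : SampleAlg α n, S.IsTester P ε (1 / 3) ∧ S.cap = cap := by
  classical
  have hp0 : 0 < M * p₀ := by positivity
  -- At the right level a member of P has mean at least 1/(2(l+1)) = 2τ; a far input has mean at
  -- most 1/(16(l+1)) = τ/4.
  set τ : ℝ := 1 / (4 * (l + 1)) with hτ
  have hτ0 : 0 < τ := by positivity
  have hτ4 : τ / 4 = 1 / (16 * (l + 1)) := by rw [hτ]; field_simp; norm_num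
  set B : ℕ → ℝ := fun j => (Fintype.card α : ℝ) ^ l * t j / (M * p₀ ^ l) with hBdef
  have hB0 : ∀ j, 0 ≤ B j := fun j => by have := ht0 j; positivity
  let H : (Fin m → α) → ℕ → Finset (Fin n) := fun w j => (F w).heavy (t (j + 1))
  let L : (Fin m → α) → ℕ → Finset (Fin n) := fun w j => (F w).light (t j)
  have hHK : ∀ w, ∀ j ≤ l, (H w j).card ≤ K j := by
    intro w j hj
    have h1 := (F w).card_heavy_mul_le (t (j + 1))
    rw [← le_div_iff₀ (ht0 _)] at h1
    exact Nat.le_of_lt_succ (by exact_mod_cast h1.trans_lt (hK j hj))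
  have hdeg : ∀ w j y, ∀ i, ∑ ω, (if i ∈ (F w).queries ω y \ H w j then
      (F w).acceptWeight (H w j ∪ L w j) y ω *
      ((M * p₀) ^ ((F w).queries ω y \ H w j).card)⁻¹ else 0) ≤ B j := fun w j y i =>
    (F w).sum_petal_weight_le hM hp₀ hp₁ (fun i hi => (Finset.mem_filter.1 hi).2.le)
      (ht0 j).le y i
  have hcard : ∀ w j y ω, ((F w).queries ω y \ H w j).card ≤ l := fun w j y ω =>
    (Finset.card_le_card Finset.sdiff_subset).trans ((F w).card_queries_le ω y)
  let A : Finset (Fin n) → (Fin n → α) → Prop := fun Q x => ∃ w, ∃ j ∈ Finset.range (l + 1),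
    ∃ κ : H w j → α, τ < (F w).estimate (M * p₀) (H w j) (L w j) (overwrite (H w j) x κ) Q
  obtain ⟨S, hS, hrun⟩ := exists_sampleAlg hp0.le hp cap A (by
    rintro Q x y hxy ⟨w, j, hj, κ, h⟩
    refine ⟨w, j, hj, κ, ?_⟩
    rwa [← (F w).estimate_congr (M * p₀) (H w j) (L w j) Q fun i hi => ?_]
    by_cases hiH : i ∈ H w j
    · simp [overwrite, hiH]
    · simp only [overwrite, hiH, dite_false]
      exact hxy i ((Finset.mem_union.1 hi).resolve_left hiH))
  have hover : sampleMean n (M * p₀) (fun Q => if Q.card ≤ cap then 0 else 1) ≤ 1 / 10 := by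
    refine (sampleMean_card_gt_le hp0.le hp cap).trans ?_
    rw [div_le_iff₀ (by positivity)]
    linarith
  refine ⟨S, ⟨fun x hx => ?_, fun x hx => ?_⟩, hS⟩
  · obtain ⟨w, hw⟩ := hcomplete x hx
    obtain ⟨j, hj, hwj⟩ := (F w).exists_le_sum_acceptWeight ht x
    have hjl : j ≤ l := Nat.lt_succ_iff.1 (Finset.mem_range.1 hj)
    have hμ : 2 * τ ≤ ∑ ω, (F w).acceptWeight (H w j ∪ L w j) x ω := by
      refine le_trans ?_ hwj
      calc 2 * τ = (1 / 2) / (l + 1) := by rw [hτ]; field_simp; norm_num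
        _ ≤ _ := by gcongr
    have hlow := petalSum_lower_tail hp0 hp ((F w).acceptWeight_nonneg _ x) (hB0 j)
      (hcard w j x) (hdeg w j x) hτ0 hμ
    -- From k ≥ 5 and k l B ≤ τ/4 follows l B ≤ τ/20.
    have hδ : 2 * (l * B j) / τ ≤ 1 / 10 := by
      rw [div_le_iff₀ hτ0]
      have h1 := hk j hjl
      have h2 : (5 : ℝ) ≤ k j := by exact_mod_cast hk5 j hjl
      have h3 : 0 ≤ l * B j := mul_nonneg (Nat.cast_nonneg _) (hB0 j)
      rw [← hτ4] at h1
      have h4 : 5 * (l * B j) ≤ k j * (l * B j) := by gcongr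
      have h5 : (k j : ℝ) * (l * B j) ≤ τ / 4 := h1
      linarith
    have := hrun x true (1 / 10) (by
      refine le_trans ?_ (hlow.trans hδ)
      refine sampleMean_mono hp0.le hp fun Q => ?_
      simp only [decide_eq_true_eq]
      split_ifs with h1 h2 h2
      · exact le_rfl
      · exact zero_le_one
      -- The kernel assignment read off from x itself leaves x unchanged.
      · refine absurd ⟨w, j, hj, fun i => x i, ?_⟩ h1
        rw [overwrite_restrict]
        exact h2
      · exact le_rfl)
    linarith
  · have := hrun x false (1 / 10) (by
      calc _ ≤ sampleMean n (M * p₀) (fun Q => ∑ w, ∑ j ∈ Finset.range (l + 1),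
            ∑ κ : H w j → α, if τ < (F w).estimate (M * p₀) (H w j) (L w j)
              (overwrite (H w j) x κ) Q then 1 else 0) := by
            refine sampleMean_mono hp0.le hp fun Q => ?_
            have hnn : ∀ w, ∀ j, ∀ κ : H w j → α, (0 : ℝ) ≤ if τ < (F w).estimate (M * p₀)
              (H w j) (L w j) (overwrite (H w j) x κ) Q then 1 else 0 := by
              intro w j κ
              split_ifs <;> norm_num
            simp only [decide_eq_false_iff_not, ite_not]
            split_ifs with h
            · obtain ⟨w, j, hj, κ, hκ⟩ := h
              refine le_trans ?_ (Finset.single_le_sum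
                (fun w _ => Finset.sum_nonneg fun j _ => Finset.sum_nonneg fun κ _ => hnn w j κ)
                (Finset.mem_univ w))
              refine le_trans ?_ (Finset.single_le_sum
                (fun j _ => Finset.sum_nonneg fun κ _ => hnn w j κ) hj)
              refine le_trans ?_ (Finset.single_le_sum
                (fun κ _ => hnn w j κ) (Finset.mem_univ κ))
              rw [if_pos hκ]
            · exact Finset.sum_nonneg fun w _ => Finset.sum_nonneg fun j _ =>
                Finset.sum_nonneg fun κ _ => hnn w j κ
        -- Union bound: at level j the at most |α|^(K j) kernel assignments cost 2^(-k j) each.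
        _ ≤ ∑ _w : Fin m → α, ∑ _j ∈ Finset.range (l + 1),
              1 / (10 * (l + 1) * (Fintype.card α : ℝ) ^ m) := by
            rw [sampleMean_sum]
            refine Finset.sum_le_sum fun w _ => ?_
            rw [sampleMean_sum]
            refine Finset.sum_le_sum fun j hj => ?_
            have hjl : j ≤ l := Nat.lt_succ_iff.1 (Finset.mem_range.1 hj)
            rw [sampleMean_sum]
            have hup : ∀ κ : H w j → α, sampleMean n (M * p₀) (fun Q =>
                if τ < (F w).estimate (M * p₀) (H w j) (L w j) (overwrite (H w j) x κ) Q
                then 1 else 0) ≤ (1 / 2) ^ k j := by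
              intro κ
              refine petalSum_upper_tail hp0 hp ((F w).acceptWeight_nonneg _ _) (hB0 j)
                (hcard w j _) (hdeg w j _) hτ0 ?_ ?_
              · rw [hτ4]
                refine ((F w).sum_acceptWeight_le _ _).trans (hsound _ (hx.overwrite hn ?_ κ) w)
                have : ((H w j).card : ℝ) ≤ K j := by exact_mod_cast hHK w j hjl
                exact this.trans (hKε j hjl)
              · rw [hτ4]
                exact hk j hjl
            refine (Finset.sum_le_sum fun κ _ => hup κ).trans ?_
            have hs : (1 : ℝ) ≤ Fintype.card α := by exact_mod_cast Fintype.card_pos (α := α)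
            rw [Finset.sum_const, Finset.card_univ, Fintype.card_fun, Fintype.card_coe,
              nsmul_eq_mul, div_pow, one_pow, mul_one_div, Nat.cast_pow]
            have h1 : (10 : ℝ) * (l + 1) * (Fintype.card α : ℝ) ^ (m + K j) ≤ 2 ^ k j := by
              exact_mod_cast hkK j hjl
            have h2 : (Fintype.card α : ℝ) ^ (H w j).card ≤ (Fintype.card α : ℝ) ^ K j :=
              pow_le_pow_right₀ hs (hHK w j hjl)
            rw [div_le_div_iff₀ (by positivity) (by positivity), one_mul]
            refine le_trans ?_ h1
            rw [pow_add]
            calc _ ≤ (Fintype.card α : ℝ) ^ K j *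
                  (10 * (l + 1) * (Fintype.card α : ℝ) ^ m) := by gcongr
              _ = _ := by ring
        _ = 1 / 10 := by
            have hs : (0 : ℝ) < Fintype.card α := by exact_mod_cast Fintype.card_pos (α := α)
            simp only [Finset.sum_const, Finset.card_univ, Fintype.card_fun, Fintype.card_fin,
              Finset.card_range, nsmul_eq_mul]
            push_cast
            field_simp)
    linarith

/-! ### Choice of thresholds, density and moments -/

/-- Collects all factors in the alphabet size and l that the moment condition leaves over, so that a
single power of n can absorb them. -/
theorem mul_pow_le_pow_mul_sq {s l : ℕ} (hs : 2 ≤ s) (hl : 1 ≤ l) :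
    (s * (l + 1) + (l + 1) + 4) * (16 * (l + 1) ^ 2) * s ^ l ≤ s ^ (8 * (l + 1) ^ 2) := by
  have h1 : l + 1 ≤ s ^ (l + 1) := (Nat.lt_pow_self (by omega)).le
  have h2 : 16 ≤ s ^ 4 := (Nat.pow_le_pow_left hs 4).trans' (by norm_num)
  have h3 : s + 3 ≤ s ^ 3 := by nlinarith [Nat.pow_le_pow_left hs 2]
  calc (s * (l + 1) + (l + 1) + 4) * (16 * (l + 1) ^ 2) * s ^ l
      ≤ ((l + 1) * (s + 3)) * (16 * (l + 1) ^ 2) * s ^ l := by gcongr; nlinarith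
    _ ≤ (s ^ (l + 1) * s ^ 3) * (s ^ 4 * (s ^ (l + 1)) ^ 2) * s ^ l := by gcongr
    _ = s ^ (l + 1 + 3 + 4 + (l + 1) * 2 + l) := by ring
    _ ≤ _ := by
        refine Nat.pow_le_pow_right (by omega) ?_
        nlinarith

theorem mul_pow_le_two_pow (s l a : ℕ) :
    10 * (l + 1) * s ^ a ≤ 2 ^ (s * a + (l + 1) + 4) := by
  have h1 : l + 1 ≤ 2 ^ (l + 1) := Nat.lt_two_pow_self.le
  have h2 : s ^ a ≤ 2 ^ (s * a) := by
    rw [pow_mul]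
    exact Nat.pow_le_pow_left Nat.lt_two_pow_self.le a
  calc 10 * (l + 1) * s ^ a ≤ 2 ^ 4 * 2 ^ (l + 1) * 2 ^ (s * a) := by gcongr; norm_num
    _ = _ := by ring

theorem rpow_le_rpow_of_rpow_le {s N a b c : ℝ} (hs : 1 ≤ s) (h : s ^ a ≤ N) (hb : 0 ≤ b)
    (hc : c ≤ a * b) : s ^ c ≤ N ^ b := by
  have hs0 : 0 ≤ s := by linarith
  calc s ^ c ≤ s ^ (a * b) := Real.rpow_le_rpow_of_exponent_le hs hc
    _ = (s ^ a) ^ b := Real.rpow_mul hs0 a b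
    _ ≤ N ^ b := Real.rpow_le_rpow (by positivity) h hb

theorem half_le_two_rpow {x : ℝ} : x / 2 ≤ (2 : ℝ) ^ x := by
  rw [Real.rpow_def_of_pos two_pos]
  have h1 := Real.add_one_le_exp (Real.log 2 * x)
  have h2 := Real.log_two_gt_d9
  rcases le_or_gt x 0 with h | h
  · have := Real.exp_pos (Real.log 2 * x)
    linarith
  · nlinarith

/-- The instance of `exists_isTester_of_queryFamily` with geometric thresholds between
`n ^ (-1 / 2)` and `1`. -/
theorem exists_isTester_of_rpow_le {α : Type u} [Fintype α] [DecidableEq α]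
    {n m l : ℕ} {Ω : Type u} [Fintype Ω] (F : (Fin m → α) → QueryFamily α n Ω l)
    {P : Set (Fin n → α)} {ε : ℝ} (hε : 0 < ε) (hs : 2 ≤ Fintype.card α) (hl : 1 ≤ l)
    (hn : (Fintype.card α : ℝ) ^ ((32 + 4 / ε) * ((l : ℝ) + 1) ^ 3) ≤ n)
    (hcomplete : ∀ x ∈ P, ∃ w, 1 / 2 ≤ (F w).acceptProb x)
    (hsound : ∀ x, IsFar (ε / 2) x P → ∀ w, (F w).acceptProb x ≤ 1 / (16 * (l + 1)))
    (hp : ((max 1 m : ℕ) : ℝ) * (n : ℝ) ^ (-(1 / (4 * ((l : ℝ) + 1) ^ 2))) ≤ 1) :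
    ∃ S : SampleAlg α n, S.IsTester P ε (1 / 3) ∧
      (S.cap : ℝ) ≤ (max 1 m : ℕ) * (n : ℝ) ^ (1 - 1 / (8 * ((l : ℝ) + 1) ^ 2)) := by
  have : Nonempty α := Fintype.card_pos_iff.1 (by omega)
  set s : ℝ := (Fintype.card α : ℝ) with hsdef
  set D : ℝ := (l : ℝ) + 1 with hD
  set M : ℝ := ((max 1 m : ℕ) : ℝ) with hMdef
  have hl' : (1 : ℝ) ≤ l := by exact_mod_cast hl
  have hD2 : 2 ≤ D := by linarith
  have hD0 : 0 < D := by linarith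
  have hs2 : (2 : ℝ) ≤ s := by rw [hsdef]; exact_mod_cast hs
  have hs1 : (1 : ℝ) ≤ s := by linarith
  have hN1 : (1 : ℝ) ≤ n := by
    have : 0 ≤ 4 / ε := by positivity
    refine le_trans (Real.one_le_rpow hs1 (by positivity)) hn
  have hN0 : (0 : ℝ) < n := by linarith
  have hM1 : 1 ≤ M := by rw [hMdef]; exact_mod_cast le_max_left 1 m
  have hmM : (m : ℝ) ≤ M := by rw [hMdef]; exact_mod_cast le_max_right 1 m
  have hεi : 0 < 4 / ε := by positivity
  -- Consecutive thresholds differ by g²: one factor g pays for p₀^(-l), the other for the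
  -- constants.
  set g : ℝ := (n : ℝ) ^ (1 / (4 * D)) with hg
  have hg0 : 0 < g := Real.rpow_pos_of_pos hN0 _
  have hsg : s ^ (8 * (l + 1) ^ 2) ≤ g := by
    rw [← Real.rpow_natCast]
    refine rpow_le_rpow_of_rpow_le hs1 hn (by positivity) ?_
    push_cast
    rw [← hD, mul_one_div, le_div_iff₀ (by positivity)]
    have : 0 ≤ 4 / ε * D ^ 3 := by positivity
    nlinarith
  -- `t 0` is n^(-1/2), which keeps kernels below l√n, and `t (l + 1)` is 1.
  set t : ℕ → ℝ := fun j => (n : ℝ) ^ (((j : ℝ) - D) / (2 * D)) with ht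
  have ht0 : ∀ j, 0 < t j := fun j => Real.rpow_pos_of_pos hN0 _
  have htm : Monotone t := by
    intro a b hab
    have : (a : ℝ) ≤ b := by exact_mod_cast hab
    refine Real.rpow_le_rpow_of_exponent_le hN1 ?_
    gcongr
  have htg : ∀ j, t j = t (j + 1) / g ^ 2 := by
    intro j
    rw [hg, ← Real.rpow_natCast, ← Real.rpow_mul hN0.le, ← Real.rpow_sub hN0]
    simp only [ht]
    congr 1
    push_cast
    field_simp
    ring
  have ht1 : ∀ j ≤ l, t (j + 1) ≤ 1 := by
    intro j hj
    have : (j : ℝ) ≤ l := by exact_mod_cast hj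
    refine Real.rpow_le_one_of_one_le_of_nonpos hN1 ?_
    refine div_nonpos_of_nonpos_of_nonneg ?_ (by positivity)
    push_cast
    linarith
  -- Chosen so that p₀^(l+1) = 1/g.
  set p₀ : ℝ := (n : ℝ) ^ (-(1 / (4 * D ^ 2))) with hp₀
  have hp0 : 0 < p₀ := Real.rpow_pos_of_pos hN0 _
  have hp1 : p₀ ≤ 1 := Real.rpow_le_one_of_one_le_of_nonpos hN1
    (neg_nonpos.2 (by positivity))
  have hpg : 1 / g ≤ p₀ ^ l := by
    calc 1 / g = p₀ ^ (l + 1) := by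
          rw [hg, hp₀, ← Real.rpow_natCast, ← Real.rpow_mul hN0.le, one_div,
            ← Real.rpow_neg hN0.le]
          congr 1
          push_cast
          rw [← hD]
          field_simp
      _ ≤ p₀ ^ l := pow_le_pow_of_le_one hp0.le hp1 (Nat.le_succ l)
  let K : ℕ → ℕ := fun j => ⌊(l : ℝ) / t (j + 1)⌋₊
  have hKle : ∀ j, (K j : ℝ) ≤ l / t (j + 1) := fun j =>
    Nat.floor_le (div_nonneg (by linarith) (ht0 _).le)
  let k : ℕ → ℕ := fun j => Fintype.card α * (m + K j) + (l + 1) + 4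
  set R : ℝ := (n : ℝ) ^ (1 - 1 / (8 * D ^ 2)) with hR
  have hR0 : 0 < R := Real.rpow_pos_of_pos hN0 _
  refine (exists_isTester_of_queryFamily (cap := ⌊M * R⌋₊)
    (Nat.cast_pos.1 hN0) F hcomplete hsound hM1 hp0 hp1 hp htm ht0 K k
    (fun j _ => Nat.lt_floor_add_one _) ?_ (fun j _ => by simp only [k]; omega) ?_
    (fun j _ => mul_pow_le_two_pow _ _ _) ?_).imp fun S hS => ⟨hS.1, ?_⟩
  · intro j hj
    -- The term 4/ε in the exponent of the lower bound on n serves here: kernels of size l√n must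
    -- stay below εn/2.
    have hr : D / ε * 2 ≤ (n : ℝ) ^ (1 / 2 : ℝ) := by
      refine le_trans ?_ (rpow_le_rpow_of_rpow_le hs1 hn (by norm_num) le_rfl)
      refine le_trans ?_ (Real.rpow_le_rpow zero_le_two hs2 (by positivity))
      refine le_trans ?_ half_le_two_rpow
      have h1 : D * 4 ≤ D ^ 3 := by nlinarith
      have h2 : 4 / ε * (D * 4) ≤ 4 / ε * D ^ 3 := by gcongr
      have h3 : 4 / ε * (D * 4) = 16 * (D / ε) := by ring
      have h4 : 0 < D / ε := by positivity
      have h5 : 0 < D ^ 3 := by positivity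
      linarith
    have hsq : (n : ℝ) ^ (1 / 2 : ℝ) * (n : ℝ) ^ (1 / 2 : ℝ) = n := by
      rw [← Real.rpow_add hN0]; norm_num
    have htl : ((n : ℝ) ^ (1 / 2 : ℝ))⁻¹ ≤ t (j + 1) := by
      have : t 0 = ((n : ℝ) ^ (1 / 2 : ℝ))⁻¹ := by
        rw [← Real.rpow_neg hN0.le]
        simp only [ht]
        congr 1
        push_cast
        field_simp
        ring
      rw [← this]
      exact htm (Nat.zero_le _)
    have hn2 : 0 < (n : ℝ) ^ (1 / 2 : ℝ) := Real.rpow_pos_of_pos hN0 _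
    calc (K j : ℝ) ≤ l / t (j + 1) := hKle j
      _ ≤ D / ((n : ℝ) ^ (1 / 2 : ℝ))⁻¹ := by gcongr; linarith
      _ = ε / 2 * ((D / ε * 2) * (n : ℝ) ^ (1 / 2 : ℝ)) := by field_simp
      _ ≤ ε / 2 * ((n : ℝ) ^ (1 / 2 : ℝ) * (n : ℝ) ^ (1 / 2 : ℝ)) := by gcongr
      _ = ε / 2 * n := by rw [hsq]
  · intro j hj
    have htp := ht0 (j + 1)
    have hz : 1 ≤ (t (j + 1))⁻¹ := (one_le_inv₀ htp).2 (ht1 j hj)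
    have hMz : 1 ≤ M * (t (j + 1))⁻¹ := one_le_mul_of_one_le_of_one_le hM1 hz
    have hkle : (k j : ℝ) ≤ M * (t (j + 1))⁻¹ * (s * D + D + 4) := by
      have h1 : (m : ℝ) ≤ M * (t (j + 1))⁻¹ * 1 := by
        rw [mul_one]
        exact hmM.trans (le_mul_of_one_le_right (by linarith) hz)
      have h2 : (K j : ℝ) ≤ M * (t (j + 1))⁻¹ * l := by
        refine (hKle j).trans ?_
        rw [div_eq_inv_mul]
        gcongr
        exact le_mul_of_one_le_left (by positivity) hM1
      have h3 : s * (m + K j) ≤ s * (M * (t (j + 1))⁻¹ * D) := by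
        gcongr
        rw [hD]
        linarith
      have h4 : D + 4 ≤ M * (t (j + 1))⁻¹ * (D + 4) :=
        le_mul_of_one_le_left (by linarith) hMz
      have h5 : (k j : ℝ) = s * (m + K j) + D + 4 := by
        simp only [k]
        push_cast
        rw [hsdef, hD]
      rw [h5]
      linarith
    have hnat : (s * D + D + 4) * (16 * D ^ 2) * s ^ l ≤ s ^ (8 * (l + 1) ^ 2) := by
      have := mul_pow_le_pow_mul_sq hs hl
      rw [hsdef, hD]
      exact_mod_cast this
    calc (k j : ℝ) * (l * (s ^ l * t j / (M * p₀ ^ l)))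
        ≤ (M * (t (j + 1))⁻¹ * (s * D + D + 4)) * (D * (s ^ l * t j / (M * (1 / g)))) := by
          have := ht0 j
          gcongr
          linarith
      -- M cancels, and `t j`/`t (j + 1)` = g^(-2) leaves one factor 1/g.
      _ = (s * D + D + 4) * D * s ^ l / g := by
          rw [htg j]
          field_simp
      _ ≤ 1 / (16 * D) := by
          rw [div_le_div_iff₀ hg0 (by positivity)]
          calc _ = (s * D + D + 4) * (16 * D ^ 2) * s ^ l := by ring
            _ ≤ 1 * g := by rw [one_mul]; exact hnat.trans hsg
  -- Passing from 1/(4D²) to 1/(8D²) in the exponent absorbs the factor 10 from Markov's bound on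
  -- the sample size.
  · have h1 : 10 ≤ (n : ℝ) ^ (1 / (8 * D ^ 2)) := by
      have h2 : (2 : ℝ) ^ (4 : ℝ) ≤ (n : ℝ) ^ (1 / (8 * D ^ 2)) := by
        refine (Real.rpow_le_rpow zero_le_two hs2 (by norm_num)).trans
          (rpow_le_rpow_of_rpow_le hs1 hn (by positivity) ?_)
        rw [mul_one_div, le_div_iff₀ (by positivity)]
        have : 0 ≤ 4 / ε * D ^ 3 := by positivity
        nlinarith
      norm_num at h2 ⊢
      linarith
    have h2 : (n : ℝ) ^ (1 / (8 * D ^ 2)) * (n * p₀) = R := by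
      rw [hp₀, hR]
      nth_rewrite 2 [← Real.rpow_one (n : ℝ)]
      rw [← Real.rpow_add hN0, ← Real.rpow_add hN0]
      congr 1
      field_simp
      ring
    have h3 : 10 * (n * p₀) ≤ R := by
      rw [← h2]
      gcongr
    calc 10 * (n * (M * p₀)) = M * (10 * (n * p₀)) := by ring
      _ ≤ M * R := by gcongr
      _ ≤ _ := (Nat.lt_floor_add_one _).le
  · rw [hS.2]
    exact Nat.floor_le (by positivity)

/-! ### Degenerate cases, number of repetitions and conclusion -/

/-- Sampling with probability 1 reads everything. This covers proofs so long that the intended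
density would exceed 1. -/
theorem exists_isTester_full {α : Type u} [DecidableEq α] {n : ℕ} (P : Set (Fin n → α))
    {ε : ℝ} (hε : 0 ≤ ε) : ∃ S : SampleAlg α n, S.IsTester P ε (1 / 3) ∧ S.cap = n := by
  classical
  obtain ⟨S, hS, hrun⟩ := exists_sampleAlg zero_le_one le_rfl n
    (fun Q x => Q = Finset.univ ∧ x ∈ P) (by
      rintro Q x y hxy ⟨rfl, hx⟩
      rw [show y = x from funext fun i => (hxy i (Finset.mem_univ i)).symm]
      exact ⟨rfl, hx⟩)
  simp only [sampleMean_one, Finset.card_univ, Fintype.card_fin, le_refl, if_true,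
    true_and] at hrun
  refine ⟨S, ⟨fun x hx => ?_, fun x hx => ?_⟩, hS⟩
  · have := hrun x true 0 (by simp [hx])
    linarith
  · have hxP : x ∉ P := fun h => by
      have := hx x h
      simp only [hammingDist_self, Nat.cast_zero, zero_div] at this
      linarith
    have := hrun x false 0 (by simp [hxP])
    linarith

theorem exists_isTester_of_subsingleton {α : Type u} [Subsingleton α] [DecidableEq α] {n : ℕ}
    (P : Set (Fin n → α)) {ε : ℝ} (hε : 0 ≤ ε) :
    ∃ S : SampleAlg α n, S.IsTester P ε (1 / 3) ∧ S.cap = 0 := by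
  classical
  have hzero : sampleMean n 0 (fun Q => if Q.card ≤ 0 then 0 else 1) ≤ 0 := by
    simpa using sampleMean_card_gt_le (n := n) le_rfl zero_le_one 0
  obtain ⟨S, hS, hrun⟩ := exists_sampleAlg le_rfl zero_le_one 0
    (fun _ x => x ∈ P) (fun Q x y _ h => Subsingleton.elim x y ▸ h)
  refine ⟨S, ⟨fun x hx => ?_, fun x hx => ?_⟩, hS⟩
  · have := hrun x true 0 (by simp [hx, sampleMean_const])
    linarith
  · have hxP : x ∉ P := fun h => by
      have := hx x h
      simp only [hammingDist_self, Nat.cast_zero, zero_div] at this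
      linarith
    have := hrun x false 0 (by simp [hxP, sampleMean_const])
    linarith

/-- The number of repetitions of a `q`-query algorithm that makes its error small compared with
the total number of queries. -/
noncomputable def numReps (q : ℕ) : ℕ := ⌈200 * Real.log q⌉₊

theorem numReps_mul_le {q : ℕ} (hq : 2 ≤ q) :
    ((2 * numReps q * q : ℕ) : ℝ) + 1 ≤ 500 * (q * Real.log q) := by
  have hq' : (2 : ℝ) ≤ q := by exact_mod_cast hq
  have hlog : 0.69 < Real.log q := by
    have := Real.log_two_gt_d9
    have := Real.log_le_log two_pos hq'
    linarith
  have h := Nat.ceil_lt_add_one (a := 200 * Real.log q) (by linarith)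
  have h2 : (numReps q : ℝ) ≤ 200 * Real.log q + 1 := h.le
  push_cast
  nlinarith

theorem pow_numReps_le {q : ℕ} (hq : 2 ≤ q) :
    (8 / 9 : ℝ) ^ numReps q ≤ 1 / (16 * (((2 * numReps q * q : ℕ) : ℝ) + 1)) := by
  have hq' : (2 : ℝ) ≤ q := by exact_mod_cast hq
  have hq0 : (0 : ℝ) < q := by linarith
  have hlog : 0 ≤ Real.log q := Real.log_nonneg (by linarith)
  have hk : 200 * Real.log q ≤ numReps q := Nat.le_ceil _
  -- 8/9 ≤ exp(-1/9) and 200/9 > 22. Of the 22 powers of q, two match (q log q) ≤ q², and the other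
  -- twenty, at least 2^20, cover the constant 16 · 500.
  have h1 : (8 / 9 : ℝ) ^ numReps q ≤ ((q : ℝ) ^ 22)⁻¹ := by
    have h2 : (8 / 9 : ℝ) ≤ Real.exp (-(1 / 9)) := by
      have := Real.add_one_le_exp (-(1 / 9 : ℝ))
      linarith
    calc (8 / 9 : ℝ) ^ numReps q ≤ Real.exp (-(1 / 9)) ^ numReps q := by gcongr
      _ = Real.exp (numReps q * -(1 / 9)) := (Real.exp_nat_mul _ _).symm
      _ ≤ Real.exp (-((22 : ℕ) * Real.log q)) := by
          refine Real.exp_le_exp.2 ?_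
          push_cast
          linarith
      _ = ((q : ℝ) ^ 22)⁻¹ := by
          rw [Real.exp_neg, Real.exp_nat_mul, Real.exp_log hq0]
  refine h1.trans ?_
  rw [one_div]
  refine inv_anti₀ (by positivity) ?_
  have h3 := numReps_mul_le hq
  have h4 : Real.log q ≤ q := Real.log_le_self hq0.le
  calc 16 * (((2 * numReps q * q : ℕ) : ℝ) + 1) ≤ 16 * (500 * (q * q)) := by
        refine mul_le_mul_of_nonneg_left (h3.trans ?_) (by norm_num)
        gcongr
    _ ≤ 2 ^ 20 * (q : ℝ) ^ 2 := by nlinarith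
    _ ≤ (q : ℝ) ^ 20 * (q : ℝ) ^ 2 := by gcongr
    _ = (q : ℝ) ^ 22 := by ring

theorem IsMAP.exists_amplified {α : Type u} [Fintype α] [DecidableEq α] {n m q : ℕ}
    {P : Set (Fin n → α)} {V : (Fin m → α) → QueryAlg α n} {ε : ℝ}
    (hV : IsMAP V P q ε (1 / 3)) {k l : ℕ} (hl : 2 * k * q = l) :
    ∃ (Ω : Type u) (_ : Fintype Ω) (F : (Fin m → α) → QueryFamily α n Ω l),
      (∀ x ∈ P, ∃ w, 1 - (8 / 9) ^ k ≤ (F w).acceptProb x) ∧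
      ∀ x, IsFar ε x P → ∀ w, (F w).acceptProb x ≤ (8 / 9) ^ k := by
  classical
  subst hl
  let _ : Fintype {f : (Fin n → α) → Finset (Fin n) × Bool // IsLocalMap q f} :=
    Fintype.ofFinite _
  choose F hF using fun w => exists_queryFamily (V w) (hV.queryBound w)
  refine ⟨_, inferInstance, fun w => (F w).amplify k, fun x hx => ?_, fun x hx w => ?_⟩
  · obtain ⟨w, hw⟩ := hV.complete x hx
    refine ⟨w, (F w).le_acceptProb_amplify k x ?_⟩
    rw [hF]
    linarith
  · refine (F w).acceptProb_amplify_le k x ?_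
    have h1 := hV.sound x hx w
    have h2 := PMF.tsum_coe ((V w).run x)
    rw [tsum_fintype (L := .unconditional Bool), Fintype.sum_bool] at h2
    have h3 := congrArg ENNReal.toReal h2
    rw [ENNReal.toReal_add (PMF.apply_ne_top _ _) (PMF.apply_ne_top _ _),
      ENNReal.toReal_one] at h3
    rw [hF]
    linarith

end LocalTest

theorem theorem7p9 :
    ∃ C : ℝ, 0 < C ∧ ∀ ε : ℝ, 0 < ε → ∃ A : ℝ, 0 < A ∧
      ∀ (α : Type u) [Fintype α] [DecidableEq α] (n m q : ℕ), 2 ≤ q →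
        (Fintype.card α : ℝ) ^ (A * (q : ℝ) ^ 3 * Real.log (q : ℝ) ^ 3) ≤ (n : ℝ) →
        ∀ (P : Set (Fin n → α)) (V : (Fin m → α) → LocalTest.QueryAlg α n),
          LocalTest.IsMAP V P q (ε / 2) (1 / 3) →
          ∃ S : LocalTest.SampleAlg α n,
            S.IsTester P ε (1 / 3) ∧
            (S.cap : ℝ) ≤ (max 1 m : ℕ) *
              (n : ℝ) ^ (1 - 1 / (C * ((q : ℝ) ^ 2 * Real.log (q : ℝ) ^ 2))) := by
  -- Both constants come from l + 1 ≤ 500 q log q, inserted in 8(l+1)² and (32 + 4/ε)(l+1)³.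
  refine ⟨8 * 500 ^ 2, by norm_num, fun ε hε => ⟨(32 + 4 / ε) * 500 ^ 3, by positivity, ?_⟩⟩
  intro α _ _ n m q hq hn P V hV
  rcases le_or_gt (Fintype.card α) 1 with hs | hs
  · have : Subsingleton α := Fintype.card_le_one_iff_subsingleton.1 hs
    obtain ⟨S, hS, hcap⟩ := LocalTest.exists_isTester_of_subsingleton P hε.le
    refine ⟨S, hS, ?_⟩
    rw [hcap, Nat.cast_zero]
    positivity
  have hDle := LocalTest.numReps_mul_le hq
  have herr := LocalTest.pow_numReps_le hq
  have hq' : (2 : ℝ) ≤ q := by exact_mod_cast hq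
  have hlog : 0 < Real.log q := Real.log_pos (by linarith)
  have hl : 1 ≤ 2 * LocalTest.numReps q * q := by
    have : 0 < LocalTest.numReps q := Nat.ceil_pos.2 (by positivity)
    have : 0 < 2 * LocalTest.numReps q * q := by positivity
    omega
  generalize hlq : 2 * LocalTest.numReps q * q = l at hDle herr hl
  obtain ⟨Ω, _, F, hcomplete, hsound⟩ := hV.exists_amplified hlq
  have hl' : (1 : ℝ) ≤ l := by exact_mod_cast hl
  have hs1 : (1 : ℝ) ≤ Fintype.card α := by exact_mod_cast hs.le
  have hn' : (Fintype.card α : ℝ) ^ ((32 + 4 / ε) * ((l : ℝ) + 1) ^ 3) ≤ n := by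
    refine (Real.rpow_le_rpow_of_exponent_le hs1 ?_).trans hn
    calc _ ≤ (32 + 4 / ε) * (500 * (q * Real.log q)) ^ 3 := by gcongr
      _ = _ := by ring
  have hN1 : (1 : ℝ) ≤ n := (Real.one_le_rpow hs1 (by positivity)).trans hn'
  have hN0 : (0 : ℝ) < n := by linarith
  have hexp : (n : ℝ) ^ (1 - 1 / (8 * ((l : ℝ) + 1) ^ 2)) ≤
      (n : ℝ) ^ (1 - 1 / (8 * 500 ^ 2 * ((q : ℝ) ^ 2 * Real.log (q : ℝ) ^ 2))) := by
    refine Real.rpow_le_rpow_of_exponent_le hN1 (sub_le_sub_left ?_ 1)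
    refine one_div_le_one_div_of_le (by positivity) ?_
    calc 8 * ((l : ℝ) + 1) ^ 2 ≤ 8 * (500 * (q * Real.log q)) ^ 2 := by gcongr
      _ = _ := by ring
  suffices h : ∃ S : LocalTest.SampleAlg α n, S.IsTester P ε (1 / 3) ∧
      (S.cap : ℝ) ≤ (max 1 m : ℕ) * (n : ℝ) ^ (1 - 1 / (8 * ((l : ℝ) + 1) ^ 2)) by
    obtain ⟨S, hS, hcap⟩ := h
    refine ⟨S, hS, hcap.trans ?_⟩
    gcongr
  -- If the density exceeds 1, the claimed sample complexity is at least n and reading the whole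
  -- input suffices.
  rcases le_or_gt (((max 1 m : ℕ) : ℝ) * (n : ℝ) ^ (-(1 / (4 * ((l : ℝ) + 1) ^ 2)))) 1
    with hp | hp
  · refine LocalTest.exists_isTester_of_rpow_le F hε hs hl hn' (fun x hx => ?_)
      (fun x hx w => (hsound x hx w).trans herr) hp
    obtain ⟨w, hw⟩ := hcomplete x hx
    refine ⟨w, le_trans ?_ hw⟩
    have : 1 / (16 * ((l : ℝ) + 1)) ≤ 1 / 2 :=
      one_div_le_one_div_of_le two_pos (by linarith)
    linarith
  · obtain ⟨S, hS, hcap⟩ := LocalTest.exists_isTester_full P hε.le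
    refine ⟨S, hS, ?_⟩
    rw [hcap]
    have h1 : (n : ℝ) ^ (1 - 1 / (4 * ((l : ℝ) + 1) ^ 2)) =
        n * (n : ℝ) ^ (-(1 / (4 * ((l : ℝ) + 1) ^ 2))) := by
      rw [sub_eq_add_neg, Real.rpow_add hN0, Real.rpow_one]
    calc (n : ℝ) ≤ n * (((max 1 m : ℕ) : ℝ) *
          (n : ℝ) ^ (-(1 / (4 * ((l : ℝ) + 1) ^ 2)))) := le_mul_of_one_le_right hN0.le hp.le
      _ = ((max 1 m : ℕ) : ℝ) * (n : ℝ) ^ (1 - 1 / (4 * ((l : ℝ) + 1) ^ 2)) := by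
          rw [h1]; ring
      _ ≤ _ := by
          gcongr
          norm_num
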